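/- **Setting.** An *mm-space* is a complete separable metric space $(X,d_X)$ of diameter at most $1$ with a Borel probability measure $\mu_X$ of full support. Let $M_\infty$ be the compact space of infinite symmetric matrices $(d_{i,j})_{i,j\in\mathbb N}$ with entries in $[0,1]$ and zero diagonal, and let $\mathcal P(\cdot)$ denote the space of Borel probability measures with the weak topology. For an mm-space $X$, let $\tau(X)\in\mathcal P(M_\infty)$ be the law of $(d_X(x_i,x_j))_{i,j}$ for an i.i.d. $\mu_X$-random sequence $(x_i)$. For a probability space $(Z,\mu)$ and a measurable $d^*:Z\times Z\to\mathcal P([0,1])$, let $\tau(Z,\mu,d^*)\in\mathcal P(M_\infty)$ be the law of the random matrix obtained by choosing an i.i.d. $\mu$-random sequence $(x_i)$ and then, for $i<j$, independent entries $d_{i,j}=d_{j,i}$ with law $d^*(x_i,x_j)$ (and $d_{i,i}=0$). The triple satisfies the *random triangle inequality* if for $\mu^3$-almost every $(a,b,c)$, independent random lengths $l(a,b),l(b,c),l(a,c)$ with laws $d^*(a,b),d^*(b,c),d^*(a,c)$ almost surely satisfy the three triangle inequalities. It is a *qmm-space* if $Z$ is standard Borel, $d^*(x,x)=\delta_0$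 and $d^*(x,y)=d^*(y,x)$ for all $x,y$, and the random triangle inequality holds. Let $\omega$ be a nonprincipal ultrafilter on $\mathbb N$ and $(X_n)$ a sequence of mm-spaces. Let $\mathbf X$ be their set-theoretic ultraproduct. Call the ultralimits $[\{A_n\}]$ of sequences of Borel sets $A_n\subset X_n$ *internal* sets, with measure $\lim_\omega\mu_{X_n}(A_n)$; a set is null if it is contained in internal sets of arbitrarily small measure; $\mathcal M$ is the $\sigma$-algebra of the sets that differ from an internal set by a null set, and $\mu_{\mathbf X}$ is the resulting probability measure on $\mathcal M$. The same construction for the spaces $X_n\times X_n$ (with $\mu_{X_n}\times\mu_{X_n}$) gives a $\sigma$-algebra $\mathcal M_2\supseteq\mathcal M\times\mathcal M$ and a measure $\mu_{\mathbf X}^2$ on $\mathbf X\times\mathbf X$. Let $\mathbf d([x_n],[y_n])=\lim_\omega d_{X_n}(x_n,y_n)$, and let $\mathbf d^*=E(\mathbf d\mid\mathcal M\times\mathcal M):\mathbf X\times\mathbf X\to\mathcal P([0,1])$ be (any version of) its Radon–Nikodym–Dunford–Pettis derivative, i.e. $\mathbf d^*$ is $\mathcal M\times\mathcal M$-measurable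 and $\int_B\langle\mathbf d^*,G\rangle\,d\mu_{\mathbf X}^2=\int_B G(\mathbf d)\,d\mu_{\mathbf X}^2$ for all $G\in C([0,1])$ and $B\in\mathcal M\times\mathcal M$. A *separable realization* of $\mathbf d^*$ consists of a measurable map $\Psi:(\mathbf X,\mathcal M)\to[0,1]$, the measure $\mu_X=\Psi_*\mu_{\mathbf X}$, and a Borel function $d_X^*:[0,1]^2\to\mathcal P([0,1])$ with $d_X^*(\Psi(\mathbf x),\Psi(\mathbf y))=\mathbf d^*(\mathbf x,\mathbf y)$ for $\mu_{\mathbf X}^2$-almost all $(\mathbf x,\mathbf y)$. **Proposition.** For every separable realization $([0,1],\mu_X,d_X^*)$: 1. $\lim_\omega\tau(X_n)=\tau([0,1],\mu_X,d_X^*)$ weakly in $\mathcal P(M_\infty)$; 2. $d_X^*(x,y)=d_X^*(y,x)$ for $\mu_X^2$-almost all $(x,y)$, and $([0,1],\mu_X,d_X^*)$ satisfies the random triangle inequality. Consequently: (a) if $d_X^*(x,x)=\delta_0$ and $d_X^*(x,y)=d_X^*(y,x)$ for all $x,y$, then $([0,1],\mu_X,d_X^*)$ is a qmm-space; (b) more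 generally, if $d_X^*(x,x)=\delta_0$ at every atom $x$ of $\mu_X$, then there is $d'=d_X^*$ $\mu_X^2$-almost everywhere such that $([0,1],\mu_X,d')$ is a qmm-space. -/

import Mathlib

open MeasureTheory Filter Topology Set
open scoped unitInterval ENNReal symmDiff

noncomputable section

namespace UltraMM

/-! ### Ultraproducts of probability spaces -/

/-- An ultrafilter on `ℕ` that is not principal. -/
class Nonprincipal (ω : Ultrafilter ℕ) : Prop where
  ne_pure : ∀ n : ℕ, ω ≠ pure n

theorem eventually_ge (ω : Ultrafilter ℕ) [Nonprincipal ω] (k : ℕ) : ∀ᶠ n in ω, k ≤ n := by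
  by_contra h
  have h' : {n | ¬ k ≤ n} ∈ ω := Ultrafilter.eventually_not.2 h
  have hf : {n : ℕ | ¬ k ≤ n}.Finite := (Set.finite_lt_nat k).subset fun n hn => by simpa using hn
  obtain ⟨x, -, hx⟩ := Ultrafilter.eq_pure_of_finite_mem hf h'
  exact Nonprincipal.ne_pure x hx

/-- The set-theoretic ultraproduct: sequences modulo equality along `ω`. -/
def UltraProduct (ω : Ultrafilter ℕ) (Y : ℕ → Type*) : Type _ :=
  Filter.Product (ω : Filter ℕ) Y

section Loeb

variable {ω : Ultrafilter ℕ} {Y : ℕ → Type*}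

/-- The class of a sequence in the ultraproduct. -/
def UltraProduct.mk (ω : Ultrafilter ℕ) (y : ∀ n, Y n) : UltraProduct ω Y :=
  Quotient.mk (productSetoid (ω : Filter ℕ) Y) y

theorem UltraProduct.exists_mk (p : UltraProduct ω Y) : ∃ y, UltraProduct.mk ω y = p :=
  Quotient.exists_rep p

/-- The ultralimit of a sequence of sets: `[y] ∈ lim_ω A_n` iff `y_n ∈ A_n` for `ω`-almost all
`n`. -/
def internalSet (ω : Ultrafilter ℕ) (A : ∀ n, Set (Y n)) : Set (UltraProduct ω Y) :=
  fun p => Quotient.liftOn p (fun y => ∀ᶠ n in ω, y n ∈ A n) fun y z h => by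
    have h' : ∀ᶠ n in (ω : Filter ℕ), y n = z n := h
    exact propext (eventually_congr (h'.mono fun n hn => by rw [hn]))

theorem mk_mem_internalSet (A : ∀ n, Set (Y n)) (y : ∀ n, Y n) :
    UltraProduct.mk ω y ∈ internalSet ω A ↔ ∀ᶠ n in ω, y n ∈ A n := Iff.rfl

theorem internalSet_mono {A B : ∀ n, Set (Y n)} (h : ∀ᶠ n in ω, A n ⊆ B n) :
    internalSet ω A ⊆ internalSet ω B := by
  intro p hp
  obtain ⟨y, rfl⟩ := p.exists_mk
  rw [mk_mem_internalSet] at *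
  filter_upwards [h, hp] with n h1 h2 using h1 h2

theorem internalSet_compl (A : ∀ n, Set (Y n)) :
    internalSet ω (fun n => (A n)ᶜ) = (internalSet ω A)ᶜ := by
  ext p
  obtain ⟨y, rfl⟩ := p.exists_mk
  rw [Set.mem_compl_iff, mk_mem_internalSet, mk_mem_internalSet]
  exact Ultrafilter.eventually_not

theorem internalSet_union (A B : ∀ n, Set (Y n)) :
    internalSet ω (fun n => A n ∪ B n) = internalSet ω A ∪ internalSet ω B := by
  ext p
  obtain ⟨y, rfl⟩ := p.exists_mk
  rw [Set.mem_union, mk_mem_internalSet, mk_mem_internalSet, mk_mem_internalSet]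
  exact Ultrafilter.eventually_or

theorem internalSet_inter (A B : ∀ n, Set (Y n)) :
    internalSet ω (fun n => A n ∩ B n) = internalSet ω A ∩ internalSet ω B := by
  ext p
  obtain ⟨y, rfl⟩ := p.exists_mk
  rw [Set.mem_inter_iff, mk_mem_internalSet, mk_mem_internalSet, mk_mem_internalSet]
  exact eventually_and

theorem internalSet_diff (A B : ∀ n, Set (Y n)) :
    internalSet ω (fun n => A n \ B n) = internalSet ω A \ internalSet ω B := by
  simp only [Set.sdiff_eq]
  rw [internalSet_inter, internalSet_compl]

theorem internalSet_empty : internalSet ω (fun n => (∅ : Set (Y n))) = ∅ := by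
  ext p
  obtain ⟨y, rfl⟩ := p.exists_mk
  rw [mk_mem_internalSet]
  simp [ω.neBot.ne]

theorem internalSet_univ : internalSet ω (fun n => (Set.univ : Set (Y n))) = Set.univ := by
  ext p
  obtain ⟨y, rfl⟩ := p.exists_mk
  rw [mk_mem_internalSet]
  simp

variable [∀ n, MeasureSpace (Y n)]

/-- The finitely additive measure on ultralimit sets: `lim_ω μ_n(A_n)`. -/
def limMeasure (ω : Ultrafilter ℕ) (A : ∀ n, Set (Y n)) : ℝ≥0∞ :=
  limUnder (ω : Filter ℕ) fun n => volume (A n)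

theorem tendsto_limMeasure (A : ∀ n, Set (Y n)) :
    Tendsto (fun n => (volume (A n) : ℝ≥0∞)) ω (𝓝 (limMeasure ω A)) :=
  Ultrafilter.le_nhds_lim (ω.map fun n => (volume (A n) : ℝ≥0∞))

theorem limMeasure_eq {A : ∀ n, Set (Y n)} {a : ℝ≥0∞}
    (h : Tendsto (fun n => (volume (A n) : ℝ≥0∞)) ω (𝓝 a)) : limMeasure ω A = a :=
  tendsto_nhds_unique (tendsto_limMeasure A) h

theorem limMeasure_mono_eventually {A B : ∀ n, Set (Y n)} (h : ∀ᶠ n in ω, A n ⊆ B n) :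
    limMeasure ω A ≤ limMeasure ω B :=
  le_of_tendsto_of_tendsto (tendsto_limMeasure A) (tendsto_limMeasure B)
    (h.mono fun _ hn => measure_mono hn)

theorem limMeasure_union_le (A B : ∀ n, Set (Y n)) :
    limMeasure ω (fun n => A n ∪ B n) ≤ limMeasure ω A + limMeasure ω B :=
  le_of_tendsto_of_tendsto (tendsto_limMeasure _)
    ((tendsto_limMeasure A).add (tendsto_limMeasure B))
    (Eventually.of_forall fun _ => measure_union_le _ _)

theorem limMeasure_union_add_inter (A : ∀ n, Set (Y n)) {B : ∀ n, Set (Y n)}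
    (hB : ∀ n, MeasurableSet (B n)) :
    limMeasure ω (fun n => A n ∪ B n) + limMeasure ω (fun n => A n ∩ B n)
      = limMeasure ω A + limMeasure ω B := by
  refine tendsto_nhds_unique ((tendsto_limMeasure _).add (tendsto_limMeasure _)) ?_
  simp only [measure_union_add_inter _ (hB _)]
  exact (tendsto_limMeasure A).add (tendsto_limMeasure B)

theorem limMeasure_empty : limMeasure ω (fun n => (∅ : Set (Y n))) = 0 :=
  limMeasure_eq (by simp)

/-- A set is null if it is covered by measurable ultralimit sets of arbitrarily small measure. -/
def IsNull (ω : Ultrafilter ℕ) (N : Set (UltraProduct ω Y)) : Prop :=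
  ∀ ε : ℝ≥0∞, 0 < ε → ∃ A : ∀ n, Set (Y n),
    (∀ n, MeasurableSet (A n)) ∧ N ⊆ internalSet ω A ∧ limMeasure ω A < ε

/-- A set is measurable if it differs from a measurable ultralimit set by a null set. -/
def IsLoebMeasurable (ω : Ultrafilter ℕ) (M : Set (UltraProduct ω Y)) : Prop :=
  ∃ P : ∀ n, Set (Y n), (∀ n, MeasurableSet (P n)) ∧ IsNull ω (M ∆ internalSet ω P)

theorem IsNull.mono {N N' : Set (UltraProduct ω Y)} (h : IsNull ω N) (hs : N' ⊆ N) :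
    IsNull ω N' := fun ε hε => by
  obtain ⟨A, hA, hN, hl⟩ := h ε hε
  exact ⟨A, hA, hs.trans hN, hl⟩

theorem isNull_empty : IsNull ω (∅ : Set (UltraProduct ω Y)) := fun ε hε =>
  ⟨fun _ => ∅, fun _ => .empty, by simp, by rwa [limMeasure_empty]⟩

theorem limMeasure_partial_le (A : ℕ → ∀ n, Set (Y n)) (k : ℕ) :
    limMeasure ω (fun n => ⋃ j ∈ Finset.range k, A j n)
      ≤ ∑ j ∈ Finset.range k, limMeasure ω (A j) :=
  le_of_tendsto_of_tendsto (tendsto_limMeasure _)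
    (tendsto_finsetSum _ fun j _ => tendsto_limMeasure (A j))
    (Eventually.of_forall fun _ => measure_biUnion_finset_le _ _)

/-- Countable saturation: a countable union of ultralimit sets is contained in an ultralimit set
of no larger measure. -/
theorem exists_internal_cover [Nonprincipal ω] [∀ n, IsProbabilityMeasure (volume : Measure (Y n))]
    (A : ℕ → ∀ n, Set (Y n)) (hA : ∀ j n, MeasurableSet (A j n)) :
    ∃ Q : ∀ n, Set (Y n), (∀ n, MeasurableSet (Q n)) ∧
      (∀ k, internalSet ω (fun n => ⋃ j ∈ Finset.range k, A j n) ⊆ internalSet ω Q) ∧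
      limMeasure ω Q ≤ ⨆ k, limMeasure ω (fun n => ⋃ j ∈ Finset.range k, A j n) := by
  classical
  set B : ℕ → ∀ n, Set (Y n) := fun k n => ⋃ j ∈ Finset.range k, A j n with hB
  have hBm : ∀ k n, MeasurableSet (B k n) := fun k n =>
    Finset.measurableSet_biUnion _ fun j _ => hA j n
  have hmono : ∀ n k l, k ≤ l → B k n ⊆ B l n := fun n k l hkl =>
    Set.biUnion_subset_biUnion_left fun j hj => by
      simp only [Finset.coe_range, Set.mem_Iio] at hj ⊢
      exact hj.trans_le hkl
  set s := ⨆ k, limMeasure ω (B k) with hs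
  set c : ℕ → ℝ≥0∞ := fun k => ((k : ℝ≥0∞) + 1)⁻¹ with hc
  have hc0 : ∀ k, 0 < c k := fun k => by
    simp only [hc, ENNReal.inv_pos]
    exact ENNReal.add_ne_top.2 ⟨ENNReal.natCast_ne_top k, ENNReal.one_ne_top⟩
  have hcanti : ∀ k l, k ≤ l → c l ≤ c k := fun k l hkl => by
    simp only [hc, ENNReal.inv_le_inv]
    gcongr
  have hle1 : ∀ k, limMeasure ω (B k) ≤ 1 := fun k =>
    le_of_tendsto (tendsto_limMeasure _) (Eventually.of_forall fun n => prob_le_one)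
  let S : ℕ → ℕ → Prop := fun n k => volume (B k n) ≤ s + c k
  let h : ℕ → ℕ := fun n => Nat.findGreatest (S n) n
  have hS0 : ∀ n, S n 0 := fun n => by simp [S, hB]
  have hSh : ∀ n, S n (h n) := fun n => Nat.findGreatest_spec (P := S n) (Nat.zero_le n) (hS0 n)
  have hSev : ∀ k, ∀ᶠ n in ω, S n k := fun k => by
    have hk : limMeasure ω (B k) < s + c k :=
      lt_of_lt_of_le (ENNReal.lt_add_right (ne_top_of_le_ne_top ENNReal.one_ne_top (hle1 k))
        (hc0 k).ne') (by gcongr; exact le_iSup (fun k => limMeasure ω (B k)) k)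
    exact ((tendsto_limMeasure (B k)).eventually (gt_mem_nhds hk)).mono fun n hn => le_of_lt hn
  have hge : ∀ k, ∀ᶠ n in ω, k ≤ h n := fun k => by
    filter_upwards [hSev k, eventually_ge ω k] with n h1 h2
    exact Nat.le_findGreatest h2 h1
  refine ⟨fun n => B (h n) n, fun n => hBm _ _, fun k => ?_, ?_⟩
  · exact internalSet_mono ((hge k).mono fun n hn => hmono n _ _ hn)
  · have hk : ∀ k, limMeasure ω (fun n => B (h n) n) ≤ s + c k := fun k =>
      le_of_tendsto (tendsto_limMeasure _) ((hge k).mono fun n hn =>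
        (hSh n).trans (by gcongr; exact hcanti _ _ hn))
    have hlim : Tendsto (fun k => s + c k) atTop (𝓝 (s + 0)) := by
      refine tendsto_const_nhds.add ?_
      have := (tendsto_add_atTop_iff_nat (f := fun k : ℕ => ((k : ℝ≥0∞))⁻¹) 1).2
        ENNReal.tendsto_inv_nat_nhds_zero
      simpa [hc] using this
    rw [add_zero] at hlim
    exact ge_of_tendsto' hlim hk

section Prob

variable [Nonprincipal ω] [∀ n, IsProbabilityMeasure (volume : Measure (Y n))]

theorem limMeasure_mono {A B : ∀ n, Set (Y n)} (h : internalSet ω A ⊆ internalSet ω B) :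
    limMeasure ω A ≤ limMeasure ω B := by
  classical
  refine limMeasure_mono_eventually ?_
  by_contra hcon
  have hcon' : ∀ᶠ n in ω, ¬ A n ⊆ B n := Ultrafilter.eventually_not.2 hcon
  have hne : ∀ n, Nonempty (Y n) := fun n => nonempty_of_isProbabilityMeasure volume
  let y : ∀ n, Y n := fun n =>
    if hn : ∃ z, z ∈ A n ∧ z ∉ B n then hn.choose else (hne n).some
  have hy : ∀ᶠ n in ω, y n ∈ A n ∧ y n ∉ B n := by
    filter_upwards [hcon'] with n hn
    have hn' : ∃ z, z ∈ A n ∧ z ∉ B n := Set.not_subset.1 hn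
    simp only [y, dif_pos hn']
    exact hn'.choose_spec
  have h1 : UltraProduct.mk ω y ∈ internalSet ω A := hy.mono fun n hn => hn.1
  have h2 := (mk_mem_internalSet B y).1 (h h1)
  obtain ⟨n, hn, hn'⟩ := (hy.and h2).exists
  exact hn.2 hn'

theorem limMeasure_eq_zero {A : ∀ n, Set (Y n)} (h : IsNull ω (internalSet ω A)) :
    limMeasure ω A = 0 := by
  by_contra hne
  obtain ⟨B, -, hAB, hl⟩ := h _ (pos_iff_ne_zero.2 hne)
  exact absurd (limMeasure_mono hAB) (not_le.2 hl)

theorem limMeasure_le_of_null {P Q : ∀ n, Set (Y n)}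
    (h : IsNull ω (internalSet ω P \ internalSet ω Q)) : limMeasure ω P ≤ limMeasure ω Q := by
  rw [← internalSet_diff] at h
  calc limMeasure ω P ≤ limMeasure ω (fun n => (P n \ Q n) ∪ Q n) :=
        limMeasure_mono_eventually (Eventually.of_forall fun n => by simp)
    _ ≤ _ := limMeasure_union_le _ _
    _ = limMeasure ω Q := by rw [limMeasure_eq_zero h, zero_add]

theorem isNull_iUnion {N : ℕ → Set (UltraProduct ω Y)} (h : ∀ k, IsNull ω (N k)) :
    IsNull ω (⋃ k, N k) := by
  intro ε hε
  obtain ⟨δ, hδ, hsum⟩ := ENNReal.exists_pos_sum_of_countable' hε.ne' ℕ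
  choose A hA hN hl using fun k => h k (δ k) (hδ k)
  obtain ⟨Q, hQ, hsub, hle⟩ := exists_internal_cover (ω := ω) A hA
  refine ⟨Q, hQ, Set.iUnion_subset fun k => (hN k).trans ?_, lt_of_le_of_lt ?_ hsum⟩
  · refine Set.Subset.trans (internalSet_mono (Eventually.of_forall fun n => ?_)) (hsub (k + 1))
    exact Set.subset_biUnion_of_mem (u := fun j => A j n) (by simp)
  · refine hle.trans (iSup_le fun k => (limMeasure_partial_le A k).trans ?_)
    exact (Finset.sum_le_sum fun j _ => (hl j).le).trans (ENNReal.sum_le_tsum _)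

theorem IsNull.union {N N' : Set (UltraProduct ω Y)} (h : IsNull ω N) (h' : IsNull ω N') :
    IsNull ω (N ∪ N') := by
  refine (isNull_iUnion (N := fun k => if k = 0 then N else N') fun k => ?_).mono ?_
  · by_cases hk : k = 0 <;> simp [hk, h, h']
  · rintro x (hx | hx)
    · exact Set.mem_iUnion.2 ⟨0, by simpa using hx⟩
    · exact Set.mem_iUnion.2 ⟨1, by simpa using hx⟩

/-- A countable union of ultralimit sets differs from an ultralimit set by a null set. -/
theorem exists_internal_iUnion (A : ℕ → ∀ n, Set (Y n)) (hA : ∀ j n, MeasurableSet (A j n)) :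
    ∃ Q : ∀ n, Set (Y n), (∀ n, MeasurableSet (Q n)) ∧
      IsNull ω ((⋃ j, internalSet ω (A j)) ∆ internalSet ω Q) ∧
      limMeasure ω Q ≤ ∑' j, limMeasure ω (A j) := by
  obtain ⟨Q, hQ, hsub, hle⟩ := exists_internal_cover (ω := ω) A hA
  set B : ℕ → ∀ n, Set (Y n) := fun k n => ⋃ j ∈ Finset.range k, A j n with hB
  have hBm : ∀ k n, MeasurableSet (B k n) := fun k n =>
    Finset.measurableSet_biUnion _ fun j _ => hA j n
  have hBsub : ∀ k, internalSet ω (B k) ⊆ ⋃ j, internalSet ω (A j) := by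
    intro k
    induction k with
    | zero =>
      simp only [hB, Finset.range_zero, Finset.notMem_empty, Set.iUnion_of_empty,
        Set.iUnion_empty, internalSet_empty, Set.empty_subset]
    | succ k ih =>
      have : B (k + 1) = fun n => A k n ∪ B k n := by
        funext n
        simp only [hB, Finset.range_add_one, Finset.set_biUnion_insert]
      rw [this, internalSet_union]
      exact Set.union_subset (Set.subset_iUnion (fun j => internalSet ω (A j)) k) ih
  have hAsub : (⋃ j, internalSet ω (A j)) ⊆ internalSet ω Q := Set.iUnion_subset fun k => by
    refine Set.Subset.trans (internalSet_mono (Eventually.of_forall fun n => ?_)) (hsub (k + 1))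
    exact Set.subset_biUnion_of_mem (u := fun j => A j n) (by simp)
  refine ⟨Q, hQ, ?_, hle.trans (iSup_le fun k =>
    (limMeasure_partial_le A k).trans (ENNReal.sum_le_tsum _))⟩
  intro ε hε
  have hQ1 : limMeasure ω Q ≤ 1 :=
    le_of_tendsto (tendsto_limMeasure _) (Eventually.of_forall fun n => prob_le_one)
  have hex : ∃ k, limMeasure ω Q < limMeasure ω (B k) + ε := by
    by_contra! hcon
    by_cases hε' : ε = ⊤
    · have := hcon 0
      simp only [hε', add_top, top_le_iff] at this
      exact ENNReal.one_ne_top (top_le_iff.1 (this ▸ hQ1))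
    have h1 : (⨆ k, limMeasure ω (B k)) + ε ≤ limMeasure ω Q := by
      rw [ENNReal.iSup_add]
      exact iSup_le hcon
    have h2 : limMeasure ω Q + ε ≤ limMeasure ω Q := le_trans (by gcongr) h1
    exact absurd h2 (not_le.2 (ENNReal.lt_add_right
      (ne_top_of_le_ne_top ENNReal.one_ne_top hQ1) hε.ne'))
  obtain ⟨k, hk⟩ := hex
  refine ⟨fun n => Q n \ B k n, fun n => (hQ n).diff (hBm k n), ?_, ?_⟩
  · rw [internalSet_diff]
    rintro x (⟨hx, hx'⟩ | ⟨hx, hx'⟩)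
    · exact absurd (hAsub hx) hx'
    · exact ⟨hx, fun hb => hx' (hBsub k hb)⟩
  · have hadd := limMeasure_union_add_inter (ω := ω) (fun n => Q n \ B k n) (hBm k)
    have hi : limMeasure ω (fun n => Q n \ B k n ∩ B k n) = 0 := by
      simp only [Set.sdiff_inter_self]
      exact limMeasure_empty
    rw [hi, add_zero] at hadd
    have hu : limMeasure ω (fun n => Q n \ B k n ∪ B k n) ≤ limMeasure ω Q := by
      refine limMeasure_mono ?_
      rw [internalSet_union, internalSet_diff]
      exact Set.union_subset Set.sdiff_subset (hsub k)
    rw [hadd] at hu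
    have hfin : limMeasure ω (B k) ≠ ⊤ := ne_top_of_le_ne_top ENNReal.one_ne_top
      (le_of_tendsto (tendsto_limMeasure _) (Eventually.of_forall fun n => prob_le_one))
    have h3 : limMeasure ω (B k) + limMeasure ω (fun n => Q n \ B k n)
        < limMeasure ω (B k) + ε := by
      rw [add_comm]
      exact hu.trans_lt hk
    exact (ENNReal.add_lt_add_iff_left hfin).1 h3

theorem isLoebMeasurable_iUnion {M : ℕ → Set (UltraProduct ω Y)} {P : ℕ → ∀ n, Set (Y n)}
    (hP : ∀ j n, MeasurableSet (P j n)) (hM : ∀ j, IsNull ω (M j ∆ internalSet ω (P j))) :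
    ∃ Q : ∀ n, Set (Y n), (∀ n, MeasurableSet (Q n)) ∧ IsNull ω ((⋃ j, M j) ∆ internalSet ω Q) ∧
      limMeasure ω Q ≤ ∑' j, limMeasure ω (P j) := by
  obtain ⟨Q, hQ, hN, hle⟩ := exists_internal_iUnion (ω := ω) P hP
  refine ⟨Q, hQ, ((isNull_iUnion hM).union hN).mono ?_, hle⟩
  refine (symmDiff_triangle (⋃ j, M j) (⋃ j, internalSet ω (P j)) (internalSet ω Q)).trans ?_
  refine sup_le_sup_right ?_ _
  rintro x (⟨hx, hx'⟩ | ⟨hx, hx'⟩)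
  · obtain ⟨j, hj⟩ := Set.mem_iUnion.1 hx
    exact Set.mem_iUnion.2 ⟨j, Or.inl ⟨hj, fun h => hx' (Set.mem_iUnion.2 ⟨j, h⟩)⟩⟩
  · obtain ⟨j, hj⟩ := Set.mem_iUnion.1 hx
    exact Set.mem_iUnion.2 ⟨j, Or.inr ⟨hj, fun h => hx' (Set.mem_iUnion.2 ⟨j, h⟩)⟩⟩

/-- The `σ`-algebra of measurable sets of the ultraproduct. -/
instance : MeasurableSpace (UltraProduct ω Y) where
  MeasurableSet' := IsLoebMeasurable ω
  measurableSet_empty := ⟨fun _ => ∅, fun _ => .empty, by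
    rw [internalSet_empty, symmDiff_self]
    exact isNull_empty⟩
  measurableSet_compl := by
    rintro M ⟨P, hP, hM⟩
    refine ⟨fun n => (P n)ᶜ, fun n => (hP n).compl, ?_⟩
    rw [internalSet_compl, compl_symmDiff_compl]
    exact hM
  measurableSet_iUnion := by
    intro M hM
    choose P hP hN using hM
    obtain ⟨Q, hQ, hN', -⟩ := isLoebMeasurable_iUnion hP hN
    exact ⟨Q, hQ, hN'⟩

/-- The value `lim_ω μ_n(P_n)` for any `P` whose ultralimit differs from `M` by a null set. -/
def loebValue (M : Set (UltraProduct ω Y)) (hM : IsLoebMeasurable ω M) : ℝ≥0∞ :=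
  limMeasure ω hM.choose

theorem loebValue_eq {M : Set (UltraProduct ω Y)} (hM : IsLoebMeasurable ω M)
    {P : ∀ n, Set (Y n)} (h : IsNull ω (M ∆ internalSet ω P)) :
    loebValue M hM = limMeasure ω P := by
  have h' := hM.choose_spec.2
  have key : IsNull ω (internalSet ω hM.choose ∆ internalSet ω P) := (h'.union h).mono (by
    have := symmDiff_triangle (internalSet ω hM.choose) M (internalSet ω P)
    rwa [symmDiff_comm (internalSet ω hM.choose) M] at this)
  exact le_antisymm (limMeasure_le_of_null (key.mono fun x hx => Or.inl hx))
    (limMeasure_le_of_null (key.mono fun x hx => Or.inr hx))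

theorem loebValue_mono {M N : Set (UltraProduct ω Y)} (hM : IsLoebMeasurable ω M)
    (hN : IsLoebMeasurable ω N) (h : M ⊆ N) : loebValue M hM ≤ loebValue N hN := by
  refine limMeasure_le_of_null ((hM.choose_spec.2.union hN.choose_spec.2).mono ?_)
  rintro x ⟨hx, hx'⟩
  by_cases hxM : x ∈ M
  · exact Or.inr (Or.inl ⟨h hxM, hx'⟩)
  · exact Or.inl (Or.inr ⟨hx, hxM⟩)

theorem loebValue_union {M N : Set (UltraProduct ω Y)} (hM : IsLoebMeasurable ω M)
    (hN : IsLoebMeasurable ω N) (hd : Disjoint M N) (hMN : IsLoebMeasurable ω (M ∪ N)) :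
    loebValue (M ∪ N) hMN = loebValue M hM + loebValue N hN := by
  obtain ⟨P, hP, hP'⟩ := id hM
  obtain ⟨Q, hQ, hQ'⟩ := id hN
  have hU : IsNull ω ((M ∪ N) ∆ internalSet ω fun n => P n ∪ Q n) := by
    rw [internalSet_union]
    refine (hP'.union hQ').mono ?_
    rintro x (⟨hx, hx'⟩ | ⟨hx, hx'⟩)
    · rw [Set.mem_union, not_or] at hx'
      exact hx.imp (fun h => Or.inl ⟨h, hx'.1⟩) (fun h => Or.inl ⟨h, hx'.2⟩)
    · rw [Set.mem_union, not_or] at hx'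
      exact hx.imp (fun h => Or.inr ⟨h, hx'.1⟩) (fun h => Or.inr ⟨h, hx'.2⟩)
  have hI : IsNull ω (internalSet ω fun n => P n ∩ Q n) := by
    rw [internalSet_inter]
    refine (hP'.union hQ').mono ?_
    rintro x ⟨hx, hx'⟩
    by_cases hxM : x ∈ M
    · exact Or.inr (Or.inr ⟨hx', Set.disjoint_left.1 hd hxM⟩)
    · exact Or.inl (Or.inr ⟨hx, hxM⟩)
  rw [loebValue_eq hM hP', loebValue_eq hN hQ', loebValue_eq hMN hU,
    ← limMeasure_union_add_inter P hQ, limMeasure_eq_zero hI, add_zero]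

theorem loebValue_iUnion {M : ℕ → Set (UltraProduct ω Y)} (hM : ∀ j, IsLoebMeasurable ω (M j))
    (hd : Pairwise (Function.onFun Disjoint M)) (hU : IsLoebMeasurable ω (⋃ j, M j)) :
    loebValue (⋃ j, M j) hU = ∑' j, loebValue (M j) (hM j) := by
  refine le_antisymm ?_ ?_
  · choose P hP hN using id hM
    obtain ⟨Q, hQ, hN', hle⟩ := isLoebMeasurable_iUnion hP hN
    rw [loebValue_eq hU hN']
    refine hle.trans (le_of_eq (tsum_congr fun j => ?_))
    rw [loebValue_eq _ (hN j)]
  · have hfin : ∀ k, IsLoebMeasurable ω (⋃ j ∈ Finset.range k, M j) := fun k =>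
      show MeasurableSet (⋃ j ∈ Finset.range k, M j) from
        Finset.measurableSet_biUnion _ fun j _ => hM j
    have hsum : ∀ k, ∑ j ∈ Finset.range k, loebValue (M j) (hM j) =
        loebValue (⋃ j ∈ Finset.range k, M j) (hfin k) := by
      intro k
      induction k with
      | zero =>
        have : IsNull ω ((⋃ j ∈ Finset.range 0, M j) ∆ internalSet ω fun n => (∅ : Set (Y n))) := by
          simpa [internalSet_empty] using isNull_empty
        rw [loebValue_eq _ this, limMeasure_empty, Finset.sum_range_zero]
      | succ k ih =>
        have hEq : (⋃ j ∈ Finset.range (k + 1), M j) = M k ∪ ⋃ j ∈ Finset.range k, M j := by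
          simp [Finset.range_add_one]
        have hdk : Disjoint (M k) (⋃ j ∈ Finset.range k, M j) := by
          refine Set.disjoint_iUnion₂_right.2 fun j hj => hd ?_
          exact (Finset.mem_range.1 hj).ne'
        have hk' : IsLoebMeasurable ω (M k ∪ ⋃ j ∈ Finset.range k, M j) := hEq ▸ hfin (k + 1)
        rw [Finset.sum_range_succ, ih, add_comm, ← loebValue_union (hM k) (hfin k) hdk hk']
        congr 1
        exact hEq.symm
    rw [ENNReal.tsum_eq_iSup_nat]
    refine iSup_le fun k => ?_
    rw [hsum]
    exact loebValue_mono _ _ (Set.iUnion₂_subset fun j _ => Set.subset_iUnion M j)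

/-- The ultraproduct measure. -/
instance : MeasureSpace (UltraProduct ω Y) where
  volume := Measure.ofMeasurable loebValue
    (by
      have : IsNull ω ((∅ : Set (UltraProduct ω Y)) ∆ internalSet ω fun n => (∅ : Set (Y n))) := by
        simpa [internalSet_empty] using isNull_empty
      exact (loebValue_eq _ this).trans limMeasure_empty)
    (fun _ hM hd => loebValue_iUnion hM hd _)

theorem volume_eq_limMeasure {M : Set (UltraProduct ω Y)} {P : ∀ n, Set (Y n)}
    (hP : ∀ n, MeasurableSet (P n)) (h : IsNull ω (M ∆ internalSet ω P)) :
    volume M = limMeasure ω P := by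
  have hM : IsLoebMeasurable ω M := ⟨P, hP, h⟩
  rw [← loebValue_eq hM h]
  exact Measure.ofMeasurable_apply M hM

instance : IsProbabilityMeasure (volume : Measure (UltraProduct ω Y)) where
  measure_univ := by
    rw [volume_eq_limMeasure (P := fun n => (Set.univ : Set (Y n))) (fun _ => .univ)
      (by rw [internalSet_univ, symmDiff_self]; exact isNull_empty)]
    exact limMeasure_eq (by simp)

end Prob

end Loeb

/-! ### Distance matrices and metric measure spaces -/

/-- The space `M_∞` of infinite symmetric matrices with entries in `[0,1]` and zero diagonal. -/
abbrev DistMatrix : Type := {m : ℕ → ℕ → I // (∀ i j, m i j = m j i) ∧ ∀ i, m i i = 0}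

/-- A metric measure space: a Polish (complete separable) metric space of diameter at most one with
a Borel probability measure of full support. -/
structure MMSpace where
  /-- The underlying set. -/
  carrier : Type*
  [metricSpace : MetricSpace carrier]
  [measureSpace : MeasureSpace carrier]
  [borelSpace : BorelSpace carrier]
  [completeSpace : CompleteSpace carrier]
  [separable : SecondCountableTopology carrier]
  [isProb : IsProbabilityMeasure (volume : Measure carrier)]
  [fullSupport : (volume : Measure carrier).IsOpenPosMeasure]
  dist_le_one : ∀ x y : carrier, dist x y ≤ 1

namespace MMSpace

instance : CoeSort MMSpace (Type _) := ⟨MMSpace.carrier⟩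

attribute [instance] metricSpace measureSpace borelSpace completeSpace separable isProb fullSupport

/-- The distance as an element of `[0,1]`. -/
def distI (X : MMSpace) (x y : X) : I := ⟨dist x y, dist_nonneg, X.dist_le_one x y⟩

/-- The distance matrix of a sequence of points. -/
def matrixOf (X : MMSpace) (x : ℕ → X) : DistMatrix :=
  ⟨fun i j => X.distI (x i) (x j), fun _ _ => Subtype.ext (dist_comm _ _),
    fun _ => Subtype.ext (dist_self _)⟩

theorem measurable_matrixOf (X : MMSpace) : Measurable X.matrixOf := by
  refine Measurable.subtype_mk (measurable_pi_lambda _ fun i => measurable_pi_lambda _ fun j => ?_)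
  refine Measurable.subtype_mk ?_
  exact (measurable_pi_apply i).dist (measurable_pi_apply j)

/-- The sampling measure `τ(X)` of an mm-space: the law of the distance matrix of an i.i.d.
sequence of points. -/
def sampling (X : MMSpace) : ProbabilityMeasure DistMatrix :=
  ⟨(Measure.infinitePi fun _ : ℕ => (volume : Measure X)).map X.matrixOf,
    Measure.isProbabilityMeasure_map X.measurable_matrixOf.aemeasurable⟩

end MMSpace

/-! ### Quantum metric measure spaces and their sampling measures -/

/-- The point mass at `t`, as an element of the space `P[0,1]` of probability measures. -/
def diracI (t : I) : ProbabilityMeasure I := ⟨Measure.dirac t, inferInstance⟩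

/-- The triangle inequality of a `P[0,1]`-valued distance: for almost all triples `(a,b,c)`,
independent random lengths with laws `d a b`, `d b c`, `d a c` almost surely satisfy the three
triangle inequalities. -/
def RandomTriangle {Ω : Type*} [MeasurableSpace Ω] (μ : ProbabilityMeasure Ω)
    (d : Ω → Ω → ProbabilityMeasure I) : Prop :=
  ∀ᵐ p : Ω × Ω × Ω ∂((μ : Measure Ω).prod ((μ : Measure Ω).prod (μ : Measure Ω))),
    ∀ᵐ l : I × I × I ∂((d p.1 p.2.1 : Measure I).prod
        ((d p.2.1 p.2.2 : Measure I).prod (d p.1 p.2.2 : Measure I))),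
      (l.2.2 : ℝ) ≤ l.1 + l.2.1 ∧ (l.1 : ℝ) ≤ l.2.1 + l.2.2 ∧ (l.2.1 : ℝ) ≤ l.1 + l.2.2

/-- Quantum metric measure spaces. -/
structure IsQMM {Ω : Type*} [MeasurableSpace Ω] [StandardBorelSpace Ω] (μ : ProbabilityMeasure Ω)
    (d : Ω → Ω → ProbabilityMeasure I) : Prop where
  measurable : Measurable (Function.uncurry d)
  diag : ∀ x, d x x = diracI 0
  symm : ∀ x y, d x y = d y x
  triangle : RandomTriangle μ d

/-- The pairs `i < j`. -/
abbrev Pairs : Type := {p : ℕ × ℕ // p.1 < p.2}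

/-- The symmetric matrix with zero diagonal and given entries above the diagonal. -/
def assemble (l : Pairs → I) : DistMatrix :=
  ⟨fun i j => if h : i < j then l ⟨(i, j), h⟩ else if h' : j < i then l ⟨(j, i), h'⟩ else 0, by
    refine ⟨fun i j => ?_, fun i => by simp⟩
    rcases lt_trichotomy i j with h | h | h
    · simp [h, h.not_gt]
    · simp [h]
    · simp [h, h.not_gt]⟩

theorem measurable_assemble : Measurable assemble := by
  refine Measurable.subtype_mk (measurable_pi_lambda _ fun i => measurable_pi_lambda _ fun j => ?_)
  by_cases h : i < j
  · simpa [h] using measurable_pi_apply (X := fun _ : Pairs => I) ⟨(i, j), h⟩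
  · by_cases h' : j < i
    · simpa [h, h'] using measurable_pi_apply (X := fun _ : Pairs => I) ⟨(j, i), h'⟩
    · simp [h, h']

/-- The probability measure on `M_∞` defined by a matrix of elements of `P[0,1]`: the entries above
the diagonal are chosen independently with the given laws (the diagonal is zero, and the
entries below it are determined by symmetry). -/
def matrixLaw (a : Pairs → ProbabilityMeasure I) : Measure DistMatrix :=
  (Measure.infinitePi fun p => (a p : Measure I)).map assemble

instance (a : Pairs → ProbabilityMeasure I) : IsProbabilityMeasure (matrixLaw a) :=
  Measure.isProbabilityMeasure_map measurable_assemble.aemeasurable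

theorem measurable_infinitePi_param {ι : Type*} :
    Measurable fun a : ι → ProbabilityMeasure I =>
      Measure.infinitePi fun p => (a p : Measure I) := by
  classical
  refine Measurable.measure_of_isPiSystem_of_isProbabilityMeasure
    (S := squareCylinders fun _ : ι => {s : Set I | MeasurableSet s})
    generateFrom_squareCylinders.symm
    (isPiSystem_squareCylinders (fun _ => MeasurableSpace.isPiSystem_measurableSet)
      fun _ => (MeasurableSet.univ : MeasurableSet (Set.univ : Set I))) ?_
  rintro _ ⟨s, t, ht, rfl⟩
  have ht' : ∀ i, MeasurableSet (t i) := fun i => by simpa using ht i (Set.mem_univ i)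
  simp only [Measure.infinitePi_pi _ fun i _ => ht' i]
  refine Finset.measurable_prod s fun i _ => ?_
  exact (Measure.measurable_coe (ht' i)).comp
    (measurable_subtype_coe.comp (measurable_pi_apply i))

theorem measurable_matrixLaw : Measurable matrixLaw :=
  (Measure.measurable_map _ measurable_assemble).comp measurable_infinitePi_param

section QSampling

variable {Ω : Type*} [MeasurableSpace Ω]

/-- The matrix of laws of the distances of a sequence of points. -/
def qMatrixOf (d : Ω → Ω → ProbabilityMeasure I) (x : ℕ → Ω) : Pairs → ProbabilityMeasure I :=
  fun p => d (x p.1.1) (x p.1.2)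

theorem measurable_qMatrixOf {d : Ω → Ω → ProbabilityMeasure I}
    (hd : Measurable (Function.uncurry d)) : Measurable (qMatrixOf d) :=
  measurable_pi_lambda _ fun p =>
    show Measurable fun x : ℕ → Ω => Function.uncurry d (x p.1.1, x p.1.2) from hd.comp ((measurable_pi_apply p.1.1).prodMk (measurable_pi_apply p.1.2))

/-- The sampling measure `τ(Ω, μ, d)`: the barycenter of the law of the random element of `P(M_∞)`
given by the matrix `d (x i) (x j)`, for an i.i.d. `μ`-random sequence of points `x i`. -/
def qSampling (μ : ProbabilityMeasure Ω) (d : Ω → Ω → ProbabilityMeasure I)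
    (hd : Measurable (Function.uncurry d)) : ProbabilityMeasure DistMatrix :=
  ⟨Measure.join ((Measure.infinitePi fun _ : ℕ => (μ : Measure Ω)).map
      fun x => matrixLaw (qMatrixOf d x)),
    isProbabilityMeasure_bind (measurable_matrixLaw.comp (measurable_qMatrixOf hd)).aemeasurable
      (Eventually.of_forall fun _ => inferInstance)⟩

end QSampling

/-! ### The ultralimit distance, its derivative and separable realizations -/

/-- The Radon-Nikodym-Dunford-Pettis derivative `E(f | 𝓑)` of the `P[0,1]`-valued function
`x ↦ δ_{f x}`: a `𝓑`-measurable `P[0,1]`-valued function `F` such that, for all continuous `G` and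
all `B ∈ 𝓑`, the functions `⟨F x, G⟩` and `G (f x)` have the same integral over `B`. -/
structure IsRNDPDerivative {Ω : Type*} [MeasurableSpace Ω] (P : Measure Ω) (𝓑 : MeasurableSpace Ω)
    (f : Ω → I) (F : Ω → ProbabilityMeasure I) : Prop where
  measurable : Measurable[𝓑] F
  setIntegral_eq : ∀ (G : C(I, ℝ)) (B : Set Ω), MeasurableSet[𝓑] B →
    ∫ x in B, (∫ t, G t ∂(F x : Measure I)) ∂P = ∫ x in B, G (f x) ∂P

section Realization

variable (ω : Ultrafilter ℕ) (X : ℕ → MMSpace)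

/-- The ultraproduct `𝐗` of a sequence of mm-spaces. -/
abbrev UX : Type _ := UltraProduct ω fun n => (X n : Type _)

/-- The ultraproduct `𝐗²` of the squares, with its own (large) `σ`-algebra and measure. -/
abbrev UX2 : Type _ := UltraProduct ω fun n => (X n × X n : Type _)

variable {ω X}

/-- First coordinate `𝐗² → 𝐗`. -/
def fstU (p : UX2 ω X) : UX ω X :=
  Quotient.map' (fun xy n => (xy n).1)
    (fun xy xy' (h : ∀ᶠ n in (ω : Filter ℕ), xy n = xy' n) => h.mono fun _ hn => by simp only [hn]) p

/-- Second coordinate `𝐗² → 𝐗`. -/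
def sndU (p : UX2 ω X) : UX ω X :=
  Quotient.map' (fun xy n => (xy n).2)
    (fun xy xy' (h : ∀ᶠ n in (ω : Filter ℕ), xy n = xy' n) => h.mono fun _ hn => by simp only [hn]) p

/-- The canonical bijection of `𝐗²` with `𝐗 × 𝐗`. -/
def splitU (p : UX2 ω X) : UX ω X × UX ω X := (fstU p, sndU p)

theorem splitU_bijective : Function.Bijective (splitU : UX2 ω X → UX ω X × UX ω X) := by
  constructor
  · intro p q h
    obtain ⟨x, rfl⟩ := p.exists_mk
    obtain ⟨y, rfl⟩ := q.exists_mk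
    have h1 : ∀ᶠ n in (ω : Filter ℕ), (x n).1 = (y n).1 := Quotient.exact (congrArg Prod.fst h)
    have h2 : ∀ᶠ n in (ω : Filter ℕ), (x n).2 = (y n).2 := Quotient.exact (congrArg Prod.snd h)
    refine Quotient.sound ?_
    show ∀ᶠ n in (ω : Filter ℕ), x n = y n
    filter_upwards [h1, h2] with n a b using Prod.ext a b
  · rintro ⟨p, q⟩
    obtain ⟨x, rfl⟩ := p.exists_mk
    obtain ⟨y, rfl⟩ := q.exists_mk
    exact ⟨UltraProduct.mk ω fun n => (x n, y n), rfl⟩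

/-- The ultralimit distance `𝐝([x], [y]) = lim_ω d_n(x_n, y_n)`. -/
def ultraDist (p : UX2 ω X) : I :=
  Quotient.liftOn p
    (fun xy => limUnder (ω : Filter ℕ) fun n => (X n).distI (xy n).1 (xy n).2)
    fun xy xy' (h : ∀ᶠ n in (ω : Filter ℕ), xy n = xy' n) => by
      have : Filter.map (fun n => (X n).distI (xy n).1 (xy n).2) (ω : Filter ℕ)
          = Filter.map (fun n => (X n).distI (xy' n).1 (xy' n).2) (ω : Filter ℕ) :=
        Filter.map_congr (h.mono fun n hn => by simp only [hn])
      simp only [limUnder, this]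

variable [Nonprincipal ω]

/-- The `σ`-algebra `𝓜 × 𝓜` on `𝐗²` (in general smaller than the `σ`-algebra `𝓜₂` of `𝐗²`). -/
@[reducible] def prodAlgebra : MeasurableSpace (UX2 ω X) :=
  MeasurableSpace.comap splitU (inferInstance : MeasurableSpace (UX ω X × UX ω X))

/-- `dstar` is a version of `𝐝* = E(𝐝 | 𝓜 × 𝓜)`. -/
def IsDerivativeOfDist (dstar : UX2 ω X → ProbabilityMeasure I) : Prop :=
  IsRNDPDerivative (volume : Measure (UX2 ω X)) prodAlgebra ultraDist dstar

/-- A separable realization of `𝐝*`: a measurable map `Ψ : 𝐗 → [0,1]` and a Borel function `d` on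
`[0,1]²` with values in `P[0,1]` whose pull-back by `Ψ` is `𝐝*` (almost everywhere). -/
structure SeparableRealization (dstar : UX2 ω X → ProbabilityMeasure I) where
  Ψ : UX ω X → I
  measurable_Ψ : Measurable Ψ
  d : I → I → ProbabilityMeasure I
  measurable_d : Measurable (Function.uncurry d)
  pullback_eq : ∀ᵐ p : UX2 ω X, d (Ψ (fstU p)) (Ψ (sndU p)) = dstar p

/-- The measure `μ_X` of a separable realization: the push-forward of `μ_𝐗` by `Ψ`. -/
def SeparableRealization.μ {dstar : UX2 ω X → ProbabilityMeasure I}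
    (R : SeparableRealization dstar) : ProbabilityMeasure I :=
  ⟨(volume : Measure (UX ω X)).map R.Ψ,
    Measure.isProbabilityMeasure_map R.measurable_Ψ.aemeasurable⟩

end Realization

end UltraMM

end

/-!
Write `Ψ` as the ultralimit of measurable functions `Ψ_n : X_n → [0,1]`. For continuous `G`, the
kernel `⟨d_X^*(Ψ_n x, Ψ_n y), G⟩`, smoothed so that it is continuous, and `G (d_n(x, y))` become
close in the cut norm along `ω`: an ultralimit of test functions violating this would be
a `𝓜 × 𝓜`-measurable function on which `𝐝*` and `𝐝` integrate differently. By the counting lemma,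
the factors of a product of functions of finitely many distances `d_{i,j}` may be replaced by
cut norm close ones, one pair `i < j` at a time, and after the replacement only the weak convergence
of the laws of `Ψ_n` is needed. By Stone–Weierstrass such products determine weak convergence of
random distance matrices. Symmetry and the triangle inequalities are closed conditions on the law of
the random matrix and pass to the limit.
-/

noncomputable section

namespace UltraMM

section Lifting

variable {ω : Ultrafilter ℕ} {Y : ℕ → Type*}

theorem eventually_mem_iff_mk_mem_internalSet (A : ∀ n, Set (Y n)) (y : ∀ n, Y n) :
    ∀ᶠ n in ω, y n ∈ A n ↔ UltraProduct.mk ω y ∈ internalSet ω A := by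
  by_cases h : UltraProduct.mk ω y ∈ internalSet ω A
  · filter_upwards [(mk_mem_internalSet A y).1 h] with n hn using iff_of_true hn h
  · filter_upwards [Ultrafilter.eventually_not.2 (mt (mk_mem_internalSet A y).2 h)] with n hn
      using iff_of_false hn h

variable [∀ n, MeasureSpace (Y n)] [Nonprincipal ω]
  [∀ n, IsProbabilityMeasure (volume : Measure (Y n))]

theorem measurableSet_internalSet {A : ∀ n, Set (Y n)} (hA : ∀ n, MeasurableSet (A n)) :
    MeasurableSet (internalSet ω A) :=
  ⟨A, hA, by rw [symmDiff_self]; exact isNull_empty⟩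

theorem volume_internalSet {A : ∀ n, Set (Y n)} (hA : ∀ n, MeasurableSet (A n)) :
    volume (internalSet ω A) = limMeasure ω A :=
  volume_eq_limMeasure hA (by rw [symmDiff_self]; exact isNull_empty)

theorem tendsto_measureReal_internalSet {A : ∀ n, Set (Y n)} (hA : ∀ n, MeasurableSet (A n)) :
    Tendsto (fun n => volume.real (A n)) ω (𝓝 (volume.real (internalSet ω A))) := by
  rw [Measure.real, volume_internalSet hA]
  refine (ENNReal.tendsto_toReal ?_).comp (tendsto_limMeasure A)
  exact volume_internalSet (ω := ω) hA ▸ measure_ne_top _ _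

theorem IsNull.volume_eq_zero {N : Set (UltraProduct ω Y)} (h : IsNull ω N) : volume N = 0 := by
  rw [volume_eq_limMeasure (P := fun _ => ∅) (fun _ => .empty) ?_, limMeasure_empty]
  rwa [internalSet_empty, ← bot_eq_empty, symmDiff_bot]

theorem exists_internalSet_ae_eq {M : Set (UltraProduct ω Y)} (hM : MeasurableSet M) :
    ∃ P : ∀ n, Set (Y n), (∀ n, MeasurableSet (P n)) ∧ internalSet ω P =ᵐ[volume] M := by
  obtain ⟨P, hP, h⟩ := hM
  exact ⟨P, hP, (measure_symmDiff_eq_zero_iff.1 h.volume_eq_zero).symm⟩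

/-- The sequence `F` lifts `f` if `f [y] = lim_ω F n (y n)` for almost every `[y]`. -/
def IsLifting {Z : Type*} [TopologicalSpace Z] (F : ∀ n, Y n → Z) (f : UltraProduct ω Y → Z) :
    Prop :=
  ∀ᵐ p, ∀ y, UltraProduct.mk ω y = p → Tendsto (fun n => F n (y n)) ω (𝓝 (f p))

namespace IsLifting

variable {Z W : Type*} [TopologicalSpace Z] [TopologicalSpace W]

theorem congr_ae {F : ∀ n, Y n → Z} {f g : UltraProduct ω Y → Z} (h : IsLifting F f)
    (hfg : f =ᵐ[volume] g) : IsLifting F g := by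
  filter_upwards [h, hfg] with p hp hpg
  rwa [← hpg]

theorem comp_continuous {F : ∀ n, Y n → Z} {f : UltraProduct ω Y → Z} (h : IsLifting F f)
    {g : Z → W} (hg : Continuous g) : IsLifting (fun n y => g (F n y)) fun p => g (f p) :=
  Eventually.mono h fun _ hp y hy => (hg.tendsto _).comp (hp y hy)

theorem prodMk {F : ∀ n, Y n → Z} {f : UltraProduct ω Y → Z} {G : ∀ n, Y n → W}
    {g : UltraProduct ω Y → W} (hF : IsLifting F f) (hG : IsLifting G g) :
    IsLifting (fun n y => (F n y, G n y)) fun p => (f p, g p) := by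
  filter_upwards [hF, hG] with p h1 h2 y hy using (h1 y hy).prodMk_nhds (h2 y hy)

theorem pi {ι : Type*} [Countable ι] {Z : ι → Type*} [∀ i, TopologicalSpace (Z i)]
    {F : ∀ n, Y n → ∀ i, Z i} {f : UltraProduct ω Y → ∀ i, Z i}
    (h : ∀ i, IsLifting (fun n y => F n y i) fun p => f p i) : IsLifting F f := by
  filter_upwards [ae_all_iff.2 h] with p hp y hy using tendsto_pi_nhds.2 fun i => hp i y hy

theorem mul {F G : ∀ n, Y n → ℝ} {f g : UltraProduct ω Y → ℝ}
    (hF : IsLifting F f) (hG : IsLifting G g) :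
    IsLifting (fun n y => F n y * G n y) fun p => f p * g p :=
  (hF.prodMk hG).comp_continuous (g := fun z => z.1 * z.2) continuous_mul

theorem sub {F G : ∀ n, Y n → ℝ} {f g : UltraProduct ω Y → ℝ}
    (hF : IsLifting F f) (hG : IsLifting G g) :
    IsLifting (fun n y => F n y - G n y) fun p => f p - g p :=
  (hF.prodMk hG).comp_continuous (g := fun z => z.1 - z.2) continuous_sub

theorem indicator_const [Zero Z] (A : ∀ n, Set (Y n)) (c : Z) :
    IsLifting (fun n => (A n).indicator fun _ => c) ((internalSet ω A).indicator fun _ => c) := by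
  classical
  refine Eventually.of_forall fun p y hy => tendsto_nhds_of_eventually_eq ?_
  filter_upwards [eventually_mem_iff_mk_mem_internalSet A y] with n hn
  simp only [indicator_apply, hn, hy]

theorem sum {κ : Type*} (s : Finset κ) {F : κ → ∀ n, Y n → ℝ} {f : κ → UltraProduct ω Y → ℝ}
    (h : ∀ k ∈ s, IsLifting (F k) (f k)) :
    IsLifting (fun n y => ∑ k ∈ s, F k n y) fun p => ∑ k ∈ s, f k p := by
  filter_upwards [(Filter.eventually_all_finset s).2 h] with p hp y hy
  exact tendsto_finsetSum _ fun k hk => hp k hk y hy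

theorem ae_abs_le {F : ∀ n, Y n → ℝ} {f : UltraProduct ω Y → ℝ} (h : IsLifting F f)
    {C : ℝ} (hC : ∀ n y, |F n y| ≤ C) : ∀ᵐ p, |f p| ≤ C := by
  filter_upwards [h] with p hp
  obtain ⟨y, rfl⟩ := p.exists_mk
  exact le_of_tendsto (hp y rfl).abs (Eventually.of_forall fun n => hC n (y n))

end IsLifting

theorem exists_isLifting_of_isCompact {Z : Type*} [TopologicalSpace Z] {F : ∀ n, Y n → Z}
    {K : Set Z} (hK : IsCompact K) (hF : ∀ n y, F n y ∈ K) :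
    ∃ f : UltraProduct ω Y → Z, IsLifting F f := by
  have hlim (y : ∀ n, Y n) : ∃ c, Tendsto (fun n => F n (y n)) ω (𝓝 c) := by
    obtain ⟨c, -, hc⟩ := hK.ultrafilter_le_nhds (ω.map fun n => F n (y n))
      (tendsto_principal.2 (Eventually.of_forall fun n => hF n (y n)))
    exact ⟨c, hc⟩
  choose c hc using hlim
  choose r hr using UltraProduct.exists_mk (ω := ω) (Y := Y)
  refine ⟨fun p => c (r p), Eventually.of_forall fun p y hy => (hc (r p)).congr' ?_⟩
  have h : ∀ᶠ n in (ω : Filter ℕ), r p n = y n := Quotient.exact ((hr p).trans hy.symm)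
  exact h.mono fun n hn => congrArg (F n) hn

end Lifting

section Integral

theorem integrable_of_measurable_of_abs_le {Ω : Type*} [MeasurableSpace Ω] {P : Measure Ω}
    [IsFiniteMeasure P] {f : Ω → ℝ} (hf : Measurable f) {C : ℝ} (hC : ∀ x, |f x| ≤ C) :
    Integrable f P :=
  Integrable.of_bound hf.aestronglyMeasurable C (Eventually.of_forall hC)

theorem abs_integral_sub_le_of_ae {Ω : Type*} [MeasurableSpace Ω] {P : Measure Ω}
    [IsProbabilityMeasure P] {f g : Ω → ℝ} (hf : Integrable f P) (hg : Integrable g P) {c : ℝ}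
    (h : ∀ᵐ x ∂P, |f x - g x| ≤ c) : |∫ x, f x ∂P - ∫ x, g x ∂P| ≤ c := by
  rw [← integral_sub hf hg]
  simpa using norm_integral_le_of_norm_le_const (μ := P) (f := fun x => f x - g x) (C := c) h

theorem integral_sum_indicator_const {Ω : Type*} [MeasurableSpace Ω] (P : Measure Ω)
    [IsFiniteMeasure P] {κ : Type*} (s : Finset κ) (c : κ → ℝ) {E : κ → Set Ω}
    (hE : ∀ k, MeasurableSet (E k)) :
    ∫ x, ∑ k ∈ s, (E k).indicator (fun _ => c k) x ∂P = ∑ k ∈ s, P.real (E k) * c k := by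
  rw [integral_finsetSum _ fun k _ => (integrable_const (c k)).indicator (hE k)]
  exact Finset.sum_congr rfl fun k _ => integral_indicator_const (c k) (hE k)

theorem tendsto_of_forall_approx {ι : Type*} {l : Filter ι} {a : ι → ℝ} {b : ℝ}
    (h : ∀ ε > 0, ∃ (a' : ι → ℝ) (b' : ℝ), Tendsto a' l (𝓝 b') ∧ (∀ᶠ i in l, |a i - a' i| ≤ ε) ∧
      |b - b'| ≤ ε) : Tendsto a l (𝓝 b) := by
  refine Metric.tendsto_nhds.2 fun ε hε => ?_
  obtain ⟨a', b', ht, ha, hb⟩ := h (ε / 4) (by positivity)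
  filter_upwards [ha, Metric.tendsto_nhds.1 ht (ε / 4) (by positivity)] with i h1 h2
  rw [Real.dist_eq, abs_lt] at *
  rw [abs_le] at *
  constructor <;> linarith

theorem abs_sub_sum_indicator_floor_le {ε C t : ℝ} (hε : 0 < ε) (ht : |t| ≤ C) :
    |t - ∑ k ∈ Finset.Icc ⌊-C / ε⌋ ⌊C / ε⌋, {s : ℝ | ⌊s / ε⌋ = k}.indicator
      (fun _ => k * ε) t| ≤ ε := by
  obtain ⟨hCt, htC⟩ := abs_le.1 ht
  have hmem : ⌊t / ε⌋ ∈ Finset.Icc ⌊-C / ε⌋ ⌊C / ε⌋ :=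
    Finset.mem_Icc.2 ⟨by gcongr, by gcongr⟩
  have hsum : ∑ k ∈ Finset.Icc ⌊-C / ε⌋ ⌊C / ε⌋, {s : ℝ | ⌊s / ε⌋ = k}.indicator
      (fun _ => k * ε) t = ⌊t / ε⌋ * ε := by
    classical
    simp only [indicator_apply, mem_ofPred_eq, Finset.sum_ite_eq, if_pos hmem]
  have hle := (le_div_iff₀ hε).1 (Int.floor_le (t / ε))
  have hlt := (div_lt_iff₀ hε).1 (Int.lt_floor_add_one (t / ε))
  rw [hsum, abs_le]
  constructor <;> linarith

variable {ω : Ultrafilter ℕ} [Nonprincipal ω] {Y : ℕ → Type*} [∀ n, MeasureSpace (Y n)]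
  [∀ n, IsProbabilityMeasure (volume : Measure (Y n))]

theorem tendsto_integral_sum_indicator {κ : Type*} (s : Finset κ) (c : κ → ℝ)
    {A : κ → ∀ n, Set (Y n)} (hA : ∀ k n, MeasurableSet (A k n)) :
    Tendsto (fun n => ∫ y, ∑ k ∈ s, (A k n).indicator (fun _ => c k) y) ω
      (𝓝 (∫ p, ∑ k ∈ s, (internalSet ω (A k)).indicator (fun _ => c k) p)) := by
  rw [integral_sum_indicator_const _ s c fun k => measurableSet_internalSet (hA k)]
  simp only [integral_sum_indicator_const _ s c fun k => hA k _]
  exact tendsto_finsetSum _ fun k _ => (tendsto_measureReal_internalSet (hA k)).mul_const _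

theorem exists_isLifting_abs_sub_le {F : ∀ n, Y n → ℝ} (hm : ∀ n, Measurable (F n)) {C : ℝ}
    (hC : ∀ n y, |F n y| ≤ C) {ε : ℝ} (hε : 0 < ε) :
    ∃ (S : ∀ n, Y n → ℝ) (s : UltraProduct ω Y → ℝ), (∀ n, Measurable (S n)) ∧ Measurable s ∧
      IsLifting S s ∧ (∀ n y, |F n y - S n y| ≤ ε) ∧
      Tendsto (fun n => ∫ y, S n y) ω (𝓝 (∫ p, s p)) := by
  let A (k : ℤ) (n : ℕ) : Set (Y n) := F n ⁻¹' {t | ⌊t / ε⌋ = k}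
  have hA (k : ℤ) (n : ℕ) : MeasurableSet (A k n) :=
    hm n ((measurable_id.div_const ε).floor (measurableSet_singleton k))
  let K : Finset ℤ := Finset.Icc ⌊-C / ε⌋ ⌊C / ε⌋
  refine ⟨fun n y => ∑ k ∈ K, (A k n).indicator (fun _ => k * ε) y,
    fun p => ∑ k ∈ K, (internalSet ω (A k)).indicator (fun _ => k * ε) p,
    fun n => ?_, ?_, IsLifting.sum _ fun k _ => IsLifting.indicator_const (A k) _,
    fun n y => abs_sub_sum_indicator_floor_le hε (hC n y),
    tendsto_integral_sum_indicator K (fun k => k * ε) hA⟩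
  · exact Finset.measurable_sum _ fun k _ => measurable_const.indicator (hA k n)
  · exact Finset.measurable_sum _ fun k _ =>
      measurable_const.indicator (measurableSet_internalSet (hA k))

namespace IsLifting

variable {F : ∀ n, Y n → ℝ} {f : UltraProduct ω Y → ℝ}

theorem aemeasurable (h : IsLifting F f) (hm : ∀ n, Measurable (F n)) {C : ℝ}
    (hC : ∀ n y, |F n y| ≤ C) : AEMeasurable f := by
  have happrox (N : ℕ) : ∃ s, Measurable s ∧ ∀ᵐ p, |f p - s p| ≤ 1 / ((N : ℝ) + 1) := by
    obtain ⟨S, s, -, hs, hSs, hFS, -⟩ :=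
      exists_isLifting_abs_sub_le (ω := ω) hm hC (Nat.one_div_pos_of_nat (α := ℝ) (n := N))
    exact ⟨s, hs, (h.sub hSs).ae_abs_le hFS⟩
  choose s hs hfs using happrox
  refine aemeasurable_of_tendsto_metrizable_ae atTop (fun N => (hs N).aemeasurable) ?_
  filter_upwards [ae_all_iff.2 hfs] with p hp
  rw [tendsto_iff_dist_tendsto_zero]
  refine squeeze_zero (fun _ => dist_nonneg) (fun N => ?_) tendsto_one_div_add_atTop_nhds_zero_nat
  rw [dist_comm, Real.dist_eq]
  exact hp N

theorem integrable (h : IsLifting F f) (hm : ∀ n, Measurable (F n)) {C : ℝ}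
    (hC : ∀ n y, |F n y| ≤ C) : Integrable f :=
  Integrable.of_bound (h.aemeasurable hm hC).aestronglyMeasurable C (h.ae_abs_le hC)

theorem tendsto_integral (h : IsLifting F f) (hm : ∀ n, Measurable (F n)) {C : ℝ}
    (hC : ∀ n y, |F n y| ≤ C) : Tendsto (fun n => ∫ y, F n y) ω (𝓝 (∫ p, f p)) := by
  refine tendsto_of_forall_approx fun ε hε => ?_
  obtain ⟨S, s, hS, -, hSs, hFS, hlim⟩ := exists_isLifting_abs_sub_le (ω := ω) hm hC hε
  have hSC (n : ℕ) (y : Y n) : |S n y| ≤ C + ε := by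
    have := abs_sub_abs_le_abs_sub (S n y) (F n y)
    rw [abs_sub_comm] at this
    linarith [hC n y, hFS n y]
  refine ⟨_, _, hlim, Eventually.of_forall fun n => ?_, ?_⟩
  · exact abs_integral_sub_le_of_ae (integrable_of_measurable_of_abs_le (hm n) (hC n))
      (integrable_of_measurable_of_abs_le (hS n) (hSC n)) (Eventually.of_forall (hFS n))
  · exact abs_integral_sub_le_of_ae (h.integrable hm hC) (hSs.integrable hS hSC)
      ((h.sub hSs).ae_abs_le hFS)

end IsLifting

theorem exists_isLifting_measurable_of_abs_le {F : ∀ n, Y n → ℝ} (hm : ∀ n, Measurable (F n))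
    {C : ℝ} (hC : ∀ n y, |F n y| ≤ C) :
    ∃ f : UltraProduct ω Y → ℝ, Measurable f ∧ IsLifting F f := by
  obtain ⟨f, hf⟩ := exists_isLifting_of_isCompact (ω := ω) isCompact_Icc
    fun n y => abs_le.1 (hC n y)
  have hfm := hf.aemeasurable hm hC
  exact ⟨hfm.mk f, hfm.measurable_mk, hf.congr_ae hfm.ae_eq_mk⟩

end Integral

section MeasurableLifting

variable {ω : Ultrafilter ℕ} [Nonprincipal ω] {Y : ℕ → Type*} [∀ n, MeasureSpace (Y n)]
  [∀ n, IsProbabilityMeasure (volume : Measure (Y n))]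

theorem exists_isLifting_fin_two {f : UltraProduct ω Y → Fin 2} (hf : Measurable f) :
    ∃ F : ∀ n, Y n → Fin 2, (∀ n, Measurable (F n)) ∧ IsLifting F f := by
  obtain ⟨P, hP, hPf⟩ := exists_internalSet_ae_eq (hf (measurableSet_singleton 1))
  refine ⟨fun n => (P n).indicator fun _ => 1, fun n => measurable_const.indicator (hP n),
    (IsLifting.indicator_const P 1).congr_ae ?_⟩
  filter_upwards [hPf.mem_iff] with p hp
  classical
  simp only [indicator_apply, hp, mem_preimage, mem_singleton_iff]
  split_ifs <;> omega

theorem measurable_digits {b : ℕ} [NeZero b] (k : ℕ) : Measurable fun x => Real.digits x b k := by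
  have hfloor : Measurable fun x : ℝ => ⌊x * b ^ (k + 1)⌋₊ := (measurable_id.mul_const _).nat_floor
  exact (measurable_of_countable (Fin.ofNat b)).comp hfloor

/-- Liftings are found one binary digit at a time. Halving the function first makes room for the
value `1`, which has no finite binary expansion below the point. -/
theorem exists_isLifting_unitInterval {f : UltraProduct ω Y → I} (hf : Measurable f) :
    ∃ F : ∀ n, Y n → I, (∀ n, Measurable (F n)) ∧ IsLifting F f := by
  let digit (k : ℕ) (p : UltraProduct ω Y) : Fin 2 := Real.digits (f p / 2) 2 k
  have hdigit (k : ℕ) : Measurable (digit k) :=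
    (measurable_digits k).comp (hf.subtype_val.div_const 2)
  choose F hF hlift using fun k => exists_isLifting_fin_two (hdigit k)
  let g (s : ℕ → Fin 2) : I := projIcc 0 1 zero_le_one (2 * Real.ofDigits s)
  have hg : Continuous g := continuous_projIcc.comp (continuous_const.mul Real.continuous_ofDigits)
  refine ⟨fun n y => g fun k => F k n y,
    fun n => hg.measurable.comp (measurable_pi_lambda _ fun k => hF k n),
    ((IsLifting.pi hlift).comp_continuous hg).congr_ae (Eventually.of_forall fun p => ?_)⟩
  have hmem : (f p : ℝ) / 2 ∈ Ico (0 : ℝ) 1 :=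
    ⟨by linarith [(f p).2.1], by linarith [(f p).2.2]⟩
  simp only [g, Real.ofDigits_digits one_lt_two hmem, mul_div_cancel₀ _ (two_ne_zero' ℝ),
    projIcc_val]

end MeasurableLifting

section WeakConvergence

variable {E Z ι κ : Type*} [TopologicalSpace E] [TopologicalSpace Z]

/-- The continuous functions on `E` of the form `x ↦ ∏ k ∈ s, f k (π k x)` with `|f k| ≤ 1`. Since
`f k` is normalised to be `1` outside of `s`, such products can be taken over a common `s`. -/
def coordinateProducts (π : κ → C(E, Z)) : Submonoid C(E, ℝ) where
  carrier := {F | ∃ (s : Finset κ) (f : κ → C(Z, ℝ)), (∀ k z, |f k z| ≤ 1) ∧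
    (∀ k, k ∉ s → f k = 1) ∧ ∀ x, F x = ∏ k ∈ s, f k (π k x)}
  one_mem' := ⟨∅, fun _ => 1, by simp, by simp, by simp⟩
  mul_mem' := by
    classical
    rintro F G ⟨s, f, hf, hfs, hF⟩ ⟨t, g, hg, hgt, hG⟩
    refine ⟨s ∪ t, fun k => f k * g k, fun k z => ?_, fun k hk => ?_, fun x => ?_⟩
    · rw [ContinuousMap.mul_apply, abs_mul]
      exact mul_le_one₀ (hf k z) (abs_nonneg _) (hg k z)
    · rw [Finset.mem_union, not_or] at hk
      simp only [hfs k hk.1, hgt k hk.2, one_mul]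
    · simp only [ContinuousMap.mul_apply, Finset.prod_mul_distrib, hF, hG]
      congr 1
      · exact Finset.prod_subset Finset.subset_union_left fun k _ hk => by simp [hfs k hk]
      · exact Finset.prod_subset Finset.subset_union_right fun k _ hk => by simp [hgt k hk]

theorem exists_mem_coordinateProducts_ne [CompactSpace Z] [T2Space Z] {π : κ → C(E, Z)} {x y : E}
    {k : κ} (hk : π k x ≠ π k y) : ∃ F ∈ coordinateProducts π, F x ≠ F y := by
  classical
  obtain ⟨f, h0, h1, h01⟩ := exists_continuous_zero_one_of_isClosed
    (isClosed_singleton (x := π k x)) (isClosed_singleton (x := π k y)) (disjoint_singleton.2 hk)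
  have hf (z : Z) : |f z| ≤ 1 := by
    rw [abs_of_nonneg (h01 z).1]
    exact (h01 z).2
  refine ⟨f.comp (π k), ⟨{k}, fun j => if j = k then f else 1, fun j z => ?_, fun j hj => ?_,
    fun x => by simp⟩, ?_⟩
  · by_cases hj : j = k <;> simp [hj, hf]
  · exact if_neg (Finset.mem_singleton.not.1 hj)
  · rw [ContinuousMap.comp_apply, ContinuousMap.comp_apply, h0 rfl, h1 rfl]
    exact zero_ne_one

variable [CompactSpace E] [MeasurableSpace E] [OpensMeasurableSpace E] {l : Filter ι}
  {P : ι → ProbabilityMeasure E} {Q : ProbabilityMeasure E}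

theorem integrable_continuousMap (P : Measure E) [IsFiniteMeasure P] (f : C(E, ℝ)) :
    Integrable f P :=
  (BoundedContinuousFunction.mkOfCompact f).integrable P

theorem tendsto_integral_of_mem_adjoin (S : Submonoid C(E, ℝ))
    (h : ∀ f ∈ S, Tendsto (fun i => ∫ x, f x ∂(P i : Measure E)) l
      (𝓝 (∫ x, f x ∂(Q : Measure E)))) {f : C(E, ℝ)}
    (hf : f ∈ Algebra.adjoin ℝ (S : Set C(E, ℝ))) :
    Tendsto (fun i => ∫ x, f x ∂(P i : Measure E)) l (𝓝 (∫ x, f x ∂(Q : Measure E))) := by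
  rw [← Subalgebra.mem_toSubmodule, Algebra.adjoin_eq_span, Submonoid.closure_eq] at hf
  induction hf using Submodule.span_induction with
  | mem f hf => exact h f hf
  | zero => simpa using tendsto_const_nhds
  | add f g _ _ hf hg =>
    simp only [ContinuousMap.add_apply,
      integral_add (integrable_continuousMap _ f) (integrable_continuousMap _ g)]
    exact hf.add hg
  | smul c f _ hf =>
    simp only [ContinuousMap.smul_apply, integral_smul]
    exact hf.const_smul c

theorem tendsto_of_forall_mem_submonoid (S : Submonoid C(E, ℝ))
    (hsep : ∀ x y, x ≠ y → ∃ f ∈ S, f x ≠ f y)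
    (h : ∀ f ∈ S, Tendsto (fun i => ∫ x, f x ∂(P i : Measure E)) l
      (𝓝 (∫ x, f x ∂(Q : Measure E)))) :
    Tendsto P l (𝓝 Q) := by
  have hadj : (Algebra.adjoin ℝ (S : Set C(E, ℝ))).SeparatesPoints := fun x y hxy => by
    obtain ⟨f, hf, hne⟩ := hsep x y hxy
    exact ⟨f, ⟨f, Algebra.subset_adjoin hf, rfl⟩, hne⟩
  refine ProbabilityMeasure.tendsto_iff_forall_integral_tendsto.2 fun f =>
    tendsto_of_forall_approx fun ε hε => ?_
  obtain ⟨g, hg, hdist⟩ := Metric.mem_closure_iff.1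
    (ContinuousMap.continuousMap_mem_subalgebra_closure_of_separatesPoints _ hadj
      f.toContinuousMap) ε hε
  have hfg (x : E) : |f x - g x| ≤ ε :=
    (ContinuousMap.dist_apply_le_dist (f := f.toContinuousMap) (g := g) x).trans hdist.le
  have hclose (R : ProbabilityMeasure E) :
      |∫ x, f x ∂(R : Measure E) - ∫ x, g x ∂(R : Measure E)| ≤ ε :=
    abs_integral_sub_le_of_ae (f.integrable _) (integrable_continuousMap _ g)
      (Eventually.of_forall hfg)
  exact ⟨_, _, tendsto_integral_of_mem_adjoin S h hg, Eventually.of_forall fun i => hclose (P i),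
    hclose Q⟩

theorem tendsto_of_forall_integral_prod [CompactSpace Z] [T2Space Z] (π : κ → C(E, Z))
    (hπ : ∀ x y, (∀ k, π k x = π k y) → x = y)
    (h : ∀ (s : Finset κ) (f : κ → C(Z, ℝ)), (∀ k z, |f k z| ≤ 1) →
      Tendsto (fun i => ∫ x, ∏ k ∈ s, f k (π k x) ∂(P i : Measure E)) l
        (𝓝 (∫ x, ∏ k ∈ s, f k (π k x) ∂(Q : Measure E)))) :
    Tendsto P l (𝓝 Q) := by
  refine tendsto_of_forall_mem_submonoid (coordinateProducts π) (fun x y hxy => ?_) ?_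
  · obtain ⟨k, hk⟩ := not_forall.1 (mt (hπ x y) hxy)
    exact exists_mem_coordinateProducts_ne hk
  · rintro F ⟨s, f, hf, -, hF⟩
    simp only [hF]
    exact h s f hf

end WeakConvergence

section InfinitePower

theorem integral_finset_prod_infinitePi {ι Ω : Type*} [MeasurableSpace Ω] (μ : ι → Measure Ω)
    [∀ i, IsProbabilityMeasure (μ i)] (s : Finset ι) {f : ι → Ω → ℝ}
    (hf : ∀ i, Measurable (f i)) :
    ∫ x, ∏ i ∈ s, f i (x i) ∂Measure.infinitePi μ = ∏ i ∈ s, ∫ t, f i t ∂μ i := by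
  have hm : Measurable fun y : s → Ω => ∏ i : s, f i (y i) :=
    Finset.measurable_prod _ fun i _ => (hf i).comp (measurable_pi_apply i)
  calc ∫ x, ∏ i ∈ s, f i (x i) ∂Measure.infinitePi μ
      = ∫ x, ∏ i : s, f i (s.restrict x i) ∂Measure.infinitePi μ := by
        simp only [← Finset.prod_coe_sort s, Finset.restrict]
    _ = ∫ y, ∏ i : s, f i (y i) ∂Measure.pi fun i : s => μ i :=
        integral_restrict_infinitePi (μ := μ) hm.aestronglyMeasurable
    _ = ∏ i : s, ∫ t, f i t ∂μ i :=
        integral_fintype_prod_eq_prod fun (i : s) (t : Ω) => f i t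
    _ = ∏ i ∈ s, ∫ t, f i t ∂μ i := Finset.prod_coe_sort s fun i => ∫ t, f i t ∂μ i

/-- The law of a family of independent points with law `P`, indexed by `ι`. -/
def infinitePower {Ω : Type*} [MeasurableSpace Ω] (ι : Type*) (P : ProbabilityMeasure Ω) :
    ProbabilityMeasure (ι → Ω) :=
  ⟨Measure.infinitePi fun _ => (P : Measure Ω), inferInstance⟩

theorem continuous_infinitePower {ι K : Type*} [Countable ι] [TopologicalSpace K] [CompactSpace K]
    [T2Space K] [SecondCountableTopology K] [MeasurableSpace K] [OpensMeasurableSpace K] :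
    Continuous (infinitePower ι : ProbabilityMeasure K → ProbabilityMeasure (ι → K)) := by
  refine continuous_iff_continuousAt.2 fun Q => tendsto_of_forall_integral_prod
    (fun i : ι => (⟨fun x => x i, continuous_apply i⟩ : C(ι → K, K))) (fun x y => funext) ?_
  intro s f _
  simp only [infinitePower, ProbabilityMeasure.coe_mk, ContinuousMap.coe_mk,
    integral_finset_prod_infinitePi _ s fun i => (f i).continuous.measurable]
  exact tendsto_finsetProd _ fun i _ =>
    ProbabilityMeasure.tendsto_iff_forall_integral_tendsto.1 tendsto_id
      (BoundedContinuousFunction.mkOfCompact (f i))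

theorem abs_integral_le_of_abs_le {Ω : Type*} [MeasurableSpace Ω] {P : Measure Ω}
    [IsProbabilityMeasure P] {f : Ω → ℝ} {C : ℝ} (hC : ∀ x, |f x| ≤ C) : |∫ x, f x ∂P| ≤ C := by
  simpa using norm_integral_le_of_norm_le_const (μ := P) (f := f) (C := C)
    (Eventually.of_forall hC)

variable {ι Ω : Type*} [DecidableEq ι]

theorem update_preimage_pi (s : Finset ι) (i : ι) (t : ι → Set Ω) :
    (fun p : (ι → Ω) × Ω => Function.update p.1 i p.2) ⁻¹' (s : Set ι).pi t
      = ((s.erase i : Finset ι) : Set ι).pi t ×ˢ if i ∈ s then t i else univ := by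
  ext ⟨x, a⟩
  simp only [mem_preimage, Set.mem_pi, Finset.mem_coe, mem_prod, Finset.mem_erase]
  constructor
  · refine fun h => ⟨fun k hk => by simpa [hk.1] using h k hk.2, ?_⟩
    split_ifs with hi
    · simpa using h i hi
    · trivial
  · rintro ⟨h1, h2⟩ k hk
    by_cases hki : k = i
    · subst hki
      simpa [hk] using h2
    · simpa [hki] using h1 k ⟨hki, hk⟩

variable [MeasurableSpace Ω] (μ : Measure Ω) [IsProbabilityMeasure μ]

theorem measurePreserving_update (i : ι) :
    MeasurePreserving (fun p : (ι → Ω) × Ω => Function.update p.1 i p.2)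
      ((Measure.infinitePi fun _ => μ).prod μ) (Measure.infinitePi fun _ => μ) := by
  refine ⟨measurable_update', Measure.eq_infinitePi _ fun s t ht => ?_⟩
  rw [Measure.map_apply measurable_update' (.pi s.countable_toSet fun _ _ => ht _),
    update_preimage_pi, Measure.prod_prod, Measure.infinitePi_pi _ fun i _ => ht i]
  split_ifs with hi
  · rw [mul_comm]
    exact Finset.mul_prod_erase s (fun i => μ (t i)) hi
  · rw [measure_univ, mul_one, Finset.erase_eq_of_notMem hi]

theorem integral_update (i : ι) {F : (ι → Ω) → ℝ} (hF : Measurable F) {C : ℝ}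
    (hC : ∀ x, |F x| ≤ C) :
    ∫ x, ∫ a, F (Function.update x i a) ∂μ ∂Measure.infinitePi (fun _ => μ)
      = ∫ x, F x ∂Measure.infinitePi fun _ => μ := by
  have hint : Integrable (fun p : (ι → Ω) × Ω => F (Function.update p.1 i p.2))
      ((Measure.infinitePi fun _ => μ).prod μ) :=
    integrable_of_measurable_of_abs_le (hF.comp measurable_update') fun p => hC _
  rw [← integral_prod _ hint]
  exact (integral_map measurable_update'.aemeasurable hF.aestronglyMeasurable).symm.trans
    (by rw [(measurePreserving_update μ i).map_eq])

theorem integral_update_update (i j : ι) {F : (ι → Ω) → ℝ} (hF : Measurable F) {C : ℝ}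
    (hC : ∀ x, |F x| ≤ C) :
    ∫ x, ∫ p : Ω × Ω, F (Function.update (Function.update x i p.1) j p.2) ∂μ.prod μ
        ∂Measure.infinitePi (fun _ => μ)
      = ∫ x, F x ∂Measure.infinitePi fun _ => μ := by
  have hFj : Measurable fun x : ι → Ω => ∫ b, F (Function.update x j b) ∂μ :=
    (StronglyMeasurable.integral_prod_right (f := fun x b => F (Function.update x j b))
      (hF.comp measurable_update').stronglyMeasurable).measurable
  rw [← integral_update μ j hF hC,
    ← integral_update μ i hFj fun x => abs_integral_le_of_abs_le fun b => hC _]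
  congr 1 with x
  refine integral_prod (fun p : Ω × Ω => F (Function.update (Function.update x i p.1) j p.2))
    (integrable_of_measurable_of_abs_le (hF.comp ?_) fun p => hC _)
  exact measurable_update'.comp (((measurable_update x).comp measurable_fst).prodMk measurable_snd)

end InfinitePower

section CutNorm

variable {Ω : Type*}

/-- The pair of points of a sequence given by a pair of indices. -/
def pairAt (x : ℕ → Ω) (q : Pairs) : Ω × Ω := (x q.1.1, x q.1.2)

theorem abs_prod_le_one {ι : Type*} (s : Finset ι) {f : ι → ℝ} (h : ∀ i ∈ s, |f i| ≤ 1) :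
    |∏ i ∈ s, f i| ≤ 1 := by
  rw [Finset.abs_prod]
  exact Finset.prod_le_one (fun _ _ => abs_nonneg _) h

/-- Any other pair `q` contains at most one of the two indices of the pair `a`. -/
theorem prod_pairAt_update_update {a : Pairs} {s : Finset Pairs} (ha : a ∉ s)
    (z : Pairs → Ω × Ω → ℝ) (x : ℕ → Ω) (b c : Ω) :
    ∏ q ∈ s, z q (pairAt (Function.update (Function.update x a.1.1 b) a.1.2 c) q)
      = (∏ q ∈ s with ¬(q.1.1 = a.1.2 ∨ q.1.2 = a.1.2), z q (pairAt (Function.update x a.1.1 b) q))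
        * ∏ q ∈ s with q.1.1 = a.1.2 ∨ q.1.2 = a.1.2,
            z q (pairAt (Function.update x a.1.2 c) q) := by
  rw [← Finset.prod_filter_mul_prod_filter_not s fun q => q.1.1 = a.1.2 ∨ q.1.2 = a.1.2, mul_comm]
  congr 1 <;> refine Finset.prod_congr rfl fun q hq => ?_ <;>
    obtain ⟨hqs, hq⟩ := Finset.mem_filter.1 hq
  · obtain ⟨h1, h2⟩ := not_or.1 hq
    simp only [pairAt, Function.update_of_ne h1, Function.update_of_ne h2]
  · have hqa : ¬(q.1.1 = a.1.1 ∧ q.1.2 = a.1.2) := fun h =>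
      ha (Subtype.ext (Prod.ext h.1 h.2) ▸ hqs)
    have := q.2
    have := a.2
    have h1 : q.1.1 ≠ a.1.1 := by omega
    have h2 : q.1.2 ≠ a.1.1 := by omega
    simp only [pairAt, Function.update_apply, if_neg h1, if_neg h2]

variable [MeasurableSpace Ω]

theorem measurable_pairAt (q : Pairs) : Measurable fun x : ℕ → Ω => pairAt x q :=
  (measurable_pi_apply _).prodMk (measurable_pi_apply _)

theorem measurable_prod_pairAt {z : Pairs → Ω × Ω → ℝ} (hz : ∀ q, Measurable (z q))
    (s : Finset Pairs) : Measurable fun x : ℕ → Ω => ∏ q ∈ s, z q (pairAt x q) :=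
  Finset.measurable_prod _ fun q _ => (hz q).comp (measurable_pairAt q)

/-- The cut norm of `W` is at most `δ`. The cut norm is taken over test functions with values in
`[-1,1]` instead of indicators of sets, which changes it by a bounded factor only. -/
def CutNormLE (μ : Measure Ω) (W : Ω × Ω → ℝ) (δ : ℝ) : Prop :=
  ∀ f g : Ω → ℝ, Measurable f → Measurable g → (∀ a, |f a| ≤ 1) → (∀ a, |g a| ≤ 1) →
    |∫ z, W z * (f z.1 * g z.2) ∂μ.prod μ| ≤ δ

theorem CutNormLE.of_integral_abs_le {μ : Measure Ω} {W : Ω × Ω → ℝ}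
    (hW : Integrable W (μ.prod μ)) {δ : ℝ} (h : ∫ z, |W z| ∂μ.prod μ ≤ δ) : CutNormLE μ W δ := by
  intro f g _ _ hf hg
  refine (abs_integral_le_integral_abs.trans (integral_mono_of_nonneg
    (Eventually.of_forall fun z => abs_nonneg _) hW.abs (Eventually.of_forall fun z => ?_))).trans h
  simp only [abs_mul]
  exact mul_le_of_le_one_right (abs_nonneg _) (mul_le_one₀ (hf _) (abs_nonneg _) (hg _))

variable {μ : Measure Ω} [IsProbabilityMeasure μ] {z : Pairs → Ω × Ω → ℝ} {δ : ℝ}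

/-- For fixed values of the points other than the two in the pair `a`, the product splits into a
function of the first point and a function of the second. -/
theorem CutNormLE.abs_integral_mul_prod_le {W : Ω × Ω → ℝ} (h : CutNormLE μ W δ)
    (hW : Measurable W) {C : ℝ} (hC : ∀ p, |W p| ≤ C) {a : Pairs} {s : Finset Pairs} (ha : a ∉ s)
    (hz : ∀ q, Measurable (z q)) (hz1 : ∀ q p, |z q p| ≤ 1) :
    |∫ x, W (pairAt x a) * ∏ q ∈ s, z q (pairAt x q) ∂Measure.infinitePi fun _ => μ| ≤ δ := by
  have hpair (x : ℕ → Ω) (p : Ω × Ω) :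
      pairAt (Function.update (Function.update x a.1.1 p.1) a.1.2 p.2) a = p := by
    simp [pairAt, Function.update_of_ne a.2.ne]
  have hprod (t : Finset Pairs) (x : ℕ → Ω) : |∏ q ∈ t, z q (pairAt x q)| ≤ 1 :=
    abs_prod_le_one t fun q _ => hz1 q _
  rw [← integral_update_update μ a.1.1 a.1.2
    (F := fun x => W (pairAt x a) * ∏ q ∈ s, z q (pairAt x q))
    ((hW.comp (measurable_pairAt a)).mul (measurable_prod_pairAt hz s)) (C := C) fun x => by
      rw [abs_mul]
      exact (mul_le_of_le_one_right (abs_nonneg _) (hprod s x)).trans (hC _)]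
  refine abs_integral_le_of_abs_le fun x => ?_
  simp only [hpair, prod_pairAt_update_update ha]
  exact h _ _ ((measurable_prod_pairAt hz _).comp (measurable_update x))
    ((measurable_prod_pairAt hz _).comp (measurable_update x)) (fun b => hprod _ _)
    fun b => hprod _ _

theorem abs_integral_prod_update_sub_le (hz : ∀ q, Measurable (z q)) (hz1 : ∀ q p, |z q p| ≤ 1)
    {w : Ω × Ω → ℝ} (hw : Measurable w) (hw1 : ∀ p, |w p| ≤ 1) {s : Finset Pairs} {a : Pairs}
    (ha : a ∈ s) (hcut : CutNormLE μ (fun p => w p - z a p) δ) :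
    |∫ x, ∏ q ∈ s, Function.update z a w q (pairAt x q) ∂Measure.infinitePi (fun _ => μ)
      - ∫ x, ∏ q ∈ s, z q (pairAt x q) ∂Measure.infinitePi fun _ => μ| ≤ δ := by
  have hint (y : Pairs → Ω × Ω → ℝ) (hy : ∀ q, Measurable (y q)) (hy1 : ∀ q p, |y q p| ≤ 1) :
      Integrable (fun x => ∏ q ∈ s, y q (pairAt x q)) (Measure.infinitePi fun _ => μ) :=
    integrable_of_measurable_of_abs_le (measurable_prod_pairAt hy s) fun x =>
      abs_prod_le_one s fun q _ => hy1 q _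
  have hsplit (x : ℕ → Ω) : ∏ q ∈ s, Function.update z a w q (pairAt x q)
      - ∏ q ∈ s, z q (pairAt x q)
      = (w (pairAt x a) - z a (pairAt x a)) * ∏ q ∈ s.erase a, z q (pairAt x q) := by
    have herase : ∏ q ∈ s.erase a, Function.update z a w q (pairAt x q)
        = ∏ q ∈ s.erase a, z q (pairAt x q) := Finset.prod_congr rfl fun q hq => by
      rw [Function.update_of_ne (Finset.ne_of_mem_erase hq)]
    rw [← Finset.mul_prod_erase s _ ha, ← Finset.mul_prod_erase s (fun q => z q (pairAt x q)) ha,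
      herase, Function.update_self, sub_mul]
  have hupd (q : Pairs) : Measurable (Function.update z a w q) ∧
      ∀ p, |Function.update z a w q p| ≤ 1 := by
    obtain rfl | hqa := eq_or_ne q a
    · rw [Function.update_self]; exact ⟨hw, hw1⟩
    · rw [Function.update_of_ne hqa]; exact ⟨hz q, hz1 q⟩
  rw [← integral_sub (hint _ (fun q => (hupd q).1) fun q => (hupd q).2) (hint _ hz hz1)]
  simp only [hsplit]
  exact hcut.abs_integral_mul_prod_le (hw.sub (hz a)) (C := 1 + 1)
    (fun p => (abs_sub _ _).trans (add_le_add (hw1 p) (hz1 a p))) (Finset.notMem_erase a s) hz hz1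

/-- The counting lemma; the factors are replaced one at a time. -/
theorem abs_integral_prod_sub_le {u v : Pairs → Ω × Ω → ℝ} (hu : ∀ q, Measurable (u q))
    (hv : ∀ q, Measurable (v q)) (hu1 : ∀ q p, |u q p| ≤ 1) (hv1 : ∀ q p, |v q p| ≤ 1)
    {s : Finset Pairs} (hcut : ∀ q ∈ s, CutNormLE μ (fun p => u q p - v q p) δ) :
    |∫ x, ∏ q ∈ s, u q (pairAt x q) ∂Measure.infinitePi (fun _ => μ)
      - ∫ x, ∏ q ∈ s, v q (pairAt x q) ∂Measure.infinitePi fun _ => μ| ≤ s.card * δ := by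
  suffices hmix : ∀ t ⊆ s, |∫ x, ∏ q ∈ s, t.piecewise u v q (pairAt x q)
        ∂Measure.infinitePi (fun _ => μ)
      - ∫ x, ∏ q ∈ s, v q (pairAt x q) ∂Measure.infinitePi fun _ => μ| ≤ t.card * δ by
    convert! hmix s subset_rfl using 5 with x
    exact Finset.prod_congr rfl fun q hq => by rw [s.piecewise_eq_of_mem u v hq]
  intro t
  induction t using Finset.induction_on with
  | empty => simp
  | insert a t hat ih =>
    intro hts
    have has : a ∈ s := hts (Finset.mem_insert_self a t)
    have hswap := abs_integral_prod_update_sub_le (z := t.piecewise u v)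
      (fun q => t.piecewise_cases u v Measurable (hu q) (hv q))
      (fun q => t.piecewise_cases u v (fun f => ∀ p, |f p| ≤ 1) (hu1 q) (hv1 q)) (hu a) (hu1 a) has
      (by simpa only [t.piecewise_eq_of_notMem u v hat] using hcut a has)
    rw [← Finset.piecewise_insert] at hswap
    calc _ ≤ _ := abs_sub_le _ _ _
      _ ≤ δ + t.card * δ := add_le_add hswap (ih ((Finset.subset_insert a t).trans hts))
      _ = _ := by rw [Finset.card_insert_of_notMem hat]; push_cast; ring

end CutNorm

section Derivative

open ProbabilityTheory

/-- The Markov kernel of a measurable family of probability measures. -/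
def kernelOf {Ω E : Type*} [MeasurableSpace Ω] [MeasurableSpace E] {F : Ω → ProbabilityMeasure E}
    (hF : Measurable F) : Kernel Ω E :=
  ⟨fun x => F x, measurable_subtype_coe.comp hF⟩

instance {Ω E : Type*} [MeasurableSpace Ω] [MeasurableSpace E] {F : Ω → ProbabilityMeasure E}
    (hF : Measurable F) : IsMarkovKernel (kernelOf hF) :=
  ⟨fun x => inferInstanceAs (IsProbabilityMeasure (F x : Measure E))⟩

/-- The integral `⟨ν, G⟩` of a continuous function. -/
def pairing (G : C(I, ℝ)) (ν : ProbabilityMeasure I) : ℝ := ∫ t, G t ∂(ν : Measure I)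

theorem measurable_pairing (G : C(I, ℝ)) : Measurable (pairing G) :=
  (StronglyMeasurable.integral_kernel
    (κ := kernelOf (E := I) (F := id) measurable_id)
    G.continuous.measurable.stronglyMeasurable).measurable

theorem abs_pairing_le {G : C(I, ℝ)} {C : ℝ} (hG : ∀ t, |G t| ≤ C) (ν : ProbabilityMeasure I) :
    |pairing G ν| ≤ C :=
  abs_integral_le_of_abs_le hG

theorem integrable_continuousMap_comp {Ω : Type*} [MeasurableSpace Ω] {P : Measure Ω}
    [IsFiniteMeasure P] {f : Ω → I} (hf : AEMeasurable f P) (G : C(I, ℝ)) :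
    Integrable (fun x => G (f x)) P :=
  Integrable.of_bound (G.continuous.measurable.comp_aemeasurable hf).aestronglyMeasurable ‖G‖
    (Eventually.of_forall fun _ => G.norm_coe_le_norm _)

namespace IsRNDPDerivative

variable {Ω : Type*} {𝓑 : MeasurableSpace Ω} [m₀ : MeasurableSpace Ω] {P : Measure Ω}
  {f : Ω → I} {F : Ω → ProbabilityMeasure I} {k : Ω → ℝ} {C : ℝ}

theorem measurable_pairing (h : IsRNDPDerivative P 𝓑 f F) (G : C(I, ℝ)) :
    Measurable[𝓑] fun x => pairing G (F x) :=
  (UltraMM.measurable_pairing G).comp h.measurable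

variable [IsProbabilityMeasure P]

theorem integrable_pairing (h : IsRNDPDerivative P 𝓑 f F) (hle : 𝓑 ≤ m₀) (G : C(I, ℝ)) :
    Integrable (fun x => pairing G (F x)) P :=
  integrable_of_measurable_of_abs_le ((h.measurable_pairing G).mono hle le_rfl) fun _ =>
    abs_pairing_le G.norm_coe_le_norm _

theorem integral_mul_eq (h : IsRNDPDerivative P 𝓑 f F) (hle : 𝓑 ≤ m₀) (hf : AEMeasurable f P)
    (G : C(I, ℝ)) (hk : Measurable[𝓑] k) (hC : ∀ᵐ x ∂P, |k x| ≤ C) :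
    ∫ x, k x * G (f x) ∂P = ∫ x, k x * pairing G (F x) ∂P := by
  have hGi := integrable_continuousMap_comp hf G
  have hcond : (fun x => pairing G (F x)) =ᵐ[P] P[fun x => G (f x) | 𝓑] :=
    ae_eq_condExp_of_forall_setIntegral_eq hle hGi
      (fun _ _ _ => (h.integrable_pairing hle G).integrableOn)
      (fun B hB _ => h.setIntegral_eq G B hB)
      (h.measurable_pairing G).stronglyMeasurable.aestronglyMeasurable
  have hpull := condExp_mul_of_stronglyMeasurable_left (μ := P) hk.stronglyMeasurable
    (hGi.bdd_mul (hk.mono hle le_rfl).aestronglyMeasurable hC) hGi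
  calc ∫ x, k x * G (f x) ∂P = ∫ x, (P[k * fun x => G (f x) | 𝓑]) x ∂P :=
        (integral_condExp hle).symm
    _ = ∫ x, k x * pairing G (F x) ∂P := by
        refine integral_congr_ae ?_
        filter_upwards [hpull, hcond] with x hx hx'
        rw [hx, Pi.mul_apply, ← hx']

theorem abs_integral_sub_mul_le (h : IsRNDPDerivative P 𝓑 f F) (hle : 𝓑 ≤ m₀)
    (hf : AEMeasurable f P) (G : C(I, ℝ)) {v : Ω → ℝ} (hv : Integrable v P)
    (hk : Measurable[𝓑] k) (hk1 : ∀ᵐ x ∂P, |k x| ≤ 1) :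
    |∫ x, (G (f x) - v x) * k x ∂P| ≤ ∫ x, |pairing G (F x) - v x| ∂P := by
  have hkm : AEStronglyMeasurable k P := (hk.mono hle le_rfl).aestronglyMeasurable
  have hFi := h.integrable_pairing hle G
  calc |∫ x, (G (f x) - v x) * k x ∂P| = |∫ x, (pairing G (F x) - v x) * k x ∂P| := by
        simp only [mul_comm _ (k _), mul_sub]
        rw [integral_sub ((integrable_continuousMap_comp hf G).bdd_mul hkm hk1)
            (hv.bdd_mul hkm hk1),
          integral_sub (hFi.bdd_mul hkm hk1) (hv.bdd_mul hkm hk1),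
          h.integral_mul_eq hle hf G hk hk1]
    _ ≤ ∫ x, |(pairing G (F x) - v x) * k x| ∂P := abs_integral_le_integral_abs
    _ ≤ ∫ x, |pairing G (F x) - v x| ∂P := by
        refine integral_mono_of_nonneg (Eventually.of_forall fun _ => abs_nonneg _)
          (hFi.sub hv).abs ?_
        filter_upwards [hk1] with x hx
        simp only [abs_mul]
        exact mul_le_of_le_one_right (abs_nonneg _) hx

end IsRNDPDerivative

end Derivative

section Square

variable {ω : Ultrafilter ℕ} {X : ℕ → MMSpace}

theorem isNull_preimage_fstU {N : Set (UX ω X)} (h : IsNull ω N) :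
    IsNull ω ((fstU : UX2 ω X → UX ω X) ⁻¹' N) := fun ε hε => by
  obtain ⟨A, hA, hN, hl⟩ := h ε hε
  refine ⟨fun n => A n ×ˢ univ, fun n => (hA n).prod .univ, fun p hp => ?_, ?_⟩
  · obtain ⟨y, rfl⟩ := p.exists_mk
    exact ((mk_mem_internalSet A fun n => (y n).1).1 (hN hp)).mono fun n hn => ⟨hn, trivial⟩
  · refine lt_of_le_of_lt (le_of_eq (limMeasure_eq ?_)) hl
    simpa only [Measure.volume_eq_prod, Measure.prod_prod, measure_univ, mul_one]
      using tendsto_limMeasure A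

theorem isNull_preimage_sndU {N : Set (UX ω X)} (h : IsNull ω N) :
    IsNull ω ((sndU : UX2 ω X → UX ω X) ⁻¹' N) := fun ε hε => by
  obtain ⟨A, hA, hN, hl⟩ := h ε hε
  refine ⟨fun n => univ ×ˢ A n, fun n => MeasurableSet.univ.prod (hA n), fun p hp => ?_, ?_⟩
  · obtain ⟨y, rfl⟩ := p.exists_mk
    exact ((mk_mem_internalSet A fun n => (y n).2).1 (hN hp)).mono fun n hn => ⟨trivial, hn⟩
  · refine lt_of_le_of_lt (le_of_eq (limMeasure_eq ?_)) hl
    simpa only [Measure.volume_eq_prod, Measure.prod_prod, measure_univ, one_mul]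
      using tendsto_limMeasure A

variable [Nonprincipal ω]

theorem isNull_symmDiff_rectangle {A B : Set (UX ω X)} {P Q : ∀ n, Set (X n)}
    (hA : IsNull ω (A ∆ internalSet ω P)) (hB : IsNull ω (B ∆ internalSet ω Q)) :
    IsNull ω ((splitU ⁻¹' (A ×ˢ B) : Set (UX2 ω X)) ∆ internalSet ω fun n => P n ×ˢ Q n) := by
  refine ((isNull_preimage_fstU hA).union (isNull_preimage_sndU hB)).mono fun p hp => ?_
  have hr : p ∈ internalSet ω (fun n => P n ×ˢ Q n) ↔
      fstU p ∈ internalSet ω P ∧ sndU p ∈ internalSet ω Q := by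
    obtain ⟨y, rfl⟩ := p.exists_mk
    exact eventually_and
  simp only [Set.mem_symmDiff, mem_preimage, splitU, mem_prod, hr, mem_union] at hp ⊢
  tauto

theorem measurable_splitU : Measurable (splitU : UX2 ω X → UX ω X × UX ω X) := by
  refine Measurable.prodMk (fun A hA => ?_) (fun B hB => ?_)
  · obtain ⟨P, hP, h⟩ := id hA
    refine ⟨fun n => P n ×ˢ univ, fun n => (hP n).prod .univ, ?_⟩
    have hrect := isNull_symmDiff_rectangle h (B := univ) (Q := fun n => univ)
      (by rw [internalSet_univ, symmDiff_self]; exact isNull_empty)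
    rwa [prod_univ] at hrect
  · obtain ⟨P, hP, h⟩ := id hB
    refine ⟨fun n => univ ×ˢ P n, fun n => MeasurableSet.univ.prod (hP n), ?_⟩
    have hrect := isNull_symmDiff_rectangle (A := univ) (P := fun n => univ)
      (by rw [internalSet_univ, symmDiff_self]; exact isNull_empty) h
    rwa [univ_prod] at hrect

theorem measurePreserving_splitU :
    MeasurePreserving (splitU : UX2 ω X → UX ω X × UX ω X) volume (volume.prod volume) := by
  refine ⟨measurable_splitU, (Measure.prod_eq fun A B hA hB => ?_).symm⟩
  rw [Measure.map_apply measurable_splitU (hA.prod hB)]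
  obtain ⟨P, hP, hAP⟩ := id hA
  obtain ⟨Q, hQ, hBQ⟩ := id hB
  rw [volume_eq_limMeasure (fun n => (hP n).prod (hQ n)) (isNull_symmDiff_rectangle hAP hBQ),
    volume_eq_limMeasure hP hAP, volume_eq_limMeasure hQ hBQ]
  refine limMeasure_eq ?_
  simp only [Measure.volume_eq_prod, Measure.prod_prod]
  have hfin : ∀ A : ∀ n, Set (X n), limMeasure ω A ≠ ⊤ := fun A =>
    ne_top_of_le_ne_top ENNReal.one_ne_top
      (le_of_tendsto (tendsto_limMeasure _) (Eventually.of_forall fun n => prob_le_one))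
  exact ENNReal.Tendsto.mul (tendsto_limMeasure P) (Or.inr (hfin Q)) (tendsto_limMeasure Q)
    (Or.inr (hfin P))

theorem measurePreserving_fstU :
    MeasurePreserving (fstU : UX2 ω X → UX ω X) volume volume :=
  measurePreserving_fst.comp measurePreserving_splitU

theorem measurePreserving_sndU :
    MeasurePreserving (sndU : UX2 ω X → UX ω X) volume volume :=
  measurePreserving_snd.comp measurePreserving_splitU

theorem IsLifting.comp_fstU {Z : Type*} [TopologicalSpace Z] {F : ∀ n, X n → Z}
    {f : UX ω X → Z} (h : IsLifting F f) :
    IsLifting (fun n (p : X n × X n) => F n p.1) fun p : UX2 ω X => f (fstU p) := by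
  filter_upwards [measurePreserving_fstU.quasiMeasurePreserving.ae h] with p hp y hy
  subst hy
  exact hp (fun n => (y n).1) rfl

theorem IsLifting.comp_sndU {Z : Type*} [TopologicalSpace Z] {F : ∀ n, X n → Z}
    {f : UX ω X → Z} (h : IsLifting F f) :
    IsLifting (fun n (p : X n × X n) => F n p.2) fun p : UX2 ω X => f (sndU p) := by
  filter_upwards [measurePreserving_sndU.quasiMeasurePreserving.ae h] with p hp y hy
  subst hy
  exact hp (fun n => (y n).2) rfl

theorem isLifting_ultraDist :
    IsLifting (fun n (p : X n × X n) => (X n).distI p.1 p.2) (ultraDist : UX2 ω X → I) :=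
  Eventually.of_forall fun p y hy => by
    subst hy
    exact Ultrafilter.le_nhds_lim (ω.map fun n => (X n).distI (y n).1 (y n).2)

theorem MMSpace.measurable_distI (Y : MMSpace) :
    Measurable fun p : Y × Y => Y.distI p.1 p.2 :=
  Measurable.subtype_mk (measurable_fst.dist measurable_snd)

theorem aemeasurable_ultraDist : AEMeasurable (ultraDist : UX2 ω X → I) := by
  have h : IsLifting (fun n (p : X n × X n) => ((X n).distI p.1 p.2 : ℝ))
      fun p : UX2 ω X => (ultraDist p : ℝ) := isLifting_ultraDist.comp_continuous
    continuous_subtype_val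
  exact (MeasurableEmbedding.subtype_coe measurableSet_Icc).aemeasurable_comp_iff.1
    (h.aemeasurable (fun n => measurable_subtype_coe.comp (X n).measurable_distI) (C := 1)
      fun n p => abs_le.2 ⟨by linarith [((X n).distI p.1 p.2).2.1], ((X n).distI p.1 p.2).2.2⟩)

theorem prodAlgebra_le :
    (prodAlgebra : MeasurableSpace (UX2 ω X)) ≤ (inferInstance : MeasurableSpace (UX2 ω X)) :=
  measurable_splitU.comap_le

theorem measurable_prodAlgebra_splitU :
    Measurable[prodAlgebra] (splitU : UX2 ω X → UX ω X × UX ω X) :=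
  comap_measurable _

end Square

section CutNormConvergence

variable {ω : Ultrafilter ℕ} [Nonprincipal ω] {X : ℕ → MMSpace}
  {dstar : UX2 ω X → ProbabilityMeasure I}

namespace SeparableRealization

variable (R : SeparableRealization dstar)

theorem measurable_pairing (G : C(I, ℝ)) :
    Measurable fun z : I × I => pairing G (R.d z.1 z.2) :=
  (UltraMM.measurable_pairing G).comp R.measurable_d

theorem measurePreserving_pair :
    MeasurePreserving (fun p : UX2 ω X => (R.Ψ (fstU p), R.Ψ (sndU p))) volume
      ((R.μ : Measure I).prod R.μ) :=
  have h : MeasurePreserving R.Ψ volume (R.μ : Measure I) := R.measurable_Ψ.measurePreserving _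
  (h.prod h).comp measurePreserving_splitU

theorem integral_comp_pair {h : I × I → ℝ} (hm : Measurable h) :
    ∫ p : UX2 ω X, h (R.Ψ (fstU p), R.Ψ (sndU p)) = ∫ z, h z ∂(R.μ : Measure I).prod R.μ := by
  rw [← R.measurePreserving_pair.map_eq,
    integral_map R.measurePreserving_pair.aemeasurable hm.aestronglyMeasurable]

theorem measurable_prodAlgebra_pair :
    Measurable[prodAlgebra] fun p : UX2 ω X => (R.Ψ (fstU p), R.Ψ (sndU p)) :=
  (R.measurable_Ψ.prodMap R.measurable_Ψ).comp measurable_prodAlgebra_splitU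

variable {R} {Ψn : ∀ n, X n → I}

theorem measurable_comp_pair (hΨn : ∀ n, Measurable (Ψn n)) (w : C(I × I, ℝ)) (n : ℕ) :
    Measurable fun p : X n × X n => w (Ψn n p.1, Ψn n p.2) :=
  w.continuous.measurable.comp ((hΨn n).prodMap (hΨn n))

theorem isLifting_comp_pair (hlift : IsLifting Ψn R.Ψ) (w : C(I × I, ℝ)) :
    IsLifting (fun n (p : X n × X n) => w (Ψn n p.1, Ψn n p.2))
      fun p : UX2 ω X => w (R.Ψ (fstU p), R.Ψ (sndU p)) :=
  (hlift.comp_fstU.prodMk hlift.comp_sndU).comp_continuous w.continuous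

theorem tendsto_integral_mul_distI (hdstar : IsDerivativeOfDist dstar)
    (hΨn : ∀ n, Measurable (Ψn n)) (hlift : IsLifting Ψn R.Ψ) (G : C(I, ℝ)) (w : C(I × I, ℝ)) :
    Tendsto (fun n => ∫ p : X n × X n, w (Ψn n p.1, Ψn n p.2) * G ((X n).distI p.1 p.2)) ω
      (𝓝 (∫ z, w z * pairing G (R.d z.1 z.2) ∂(R.μ : Measure I).prod R.μ)) := by
  have hlim := ((isLifting_comp_pair hlift w).mul
    (isLifting_ultraDist.comp_continuous G.continuous)).tendsto_integral (C := ‖w‖ * ‖G‖)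
    (fun n => (measurable_comp_pair hΨn w n).mul
      (G.continuous.measurable.comp (X n).measurable_distI))
    fun n p => by
      rw [abs_mul]
      exact mul_le_mul (w.norm_coe_le_norm _) (G.norm_coe_le_norm _) (abs_nonneg _) (norm_nonneg _)
  convert! hlim using 2
  calc ∫ z, w z * pairing G (R.d z.1 z.2) ∂(R.μ : Measure I).prod R.μ
      = ∫ p : UX2 ω X, w (R.Ψ (fstU p), R.Ψ (sndU p)) *
          pairing G (R.d (R.Ψ (fstU p)) (R.Ψ (sndU p))) :=
        (R.integral_comp_pair (w.continuous.measurable.mul (R.measurable_pairing G))).symm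
    _ = ∫ p : UX2 ω X, w (R.Ψ (fstU p), R.Ψ (sndU p)) * pairing G (dstar p) :=
        integral_congr_ae (R.pullback_eq.mono fun p hp => by simp only [hp])
    _ = ∫ p : UX2 ω X, w (R.Ψ (fstU p), R.Ψ (sndU p)) * G (ultraDist p) :=
        (IsRNDPDerivative.integral_mul_eq hdstar prodAlgebra_le aemeasurable_ultraDist G
          (w.continuous.measurable.comp R.measurable_prodAlgebra_pair)
          (Eventually.of_forall fun _ => w.norm_coe_le_norm _)).symm

theorem abs_integral_ultraDist_sub_mul_le (hdstar : IsDerivativeOfDist dstar) (G : C(I, ℝ))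
    (w : C(I × I, ℝ)) {f g : UX ω X → ℝ} (hf : Measurable f) (hg : Measurable g)
    (hf1 : ∀ᵐ x, |f x| ≤ 1) (hg1 : ∀ᵐ x, |g x| ≤ 1) :
    |∫ p : UX2 ω X, (G (ultraDist p) - w (R.Ψ (fstU p), R.Ψ (sndU p))) *
        (f (fstU p) * g (sndU p))|
      ≤ ∫ z, |pairing G (R.d z.1 z.2) - w z| ∂(R.μ : Measure I).prod R.μ := by
  have hv : Measurable[prodAlgebra] fun p : UX2 ω X => w (R.Ψ (fstU p), R.Ψ (sndU p)) :=
    w.continuous.measurable.comp R.measurable_prodAlgebra_pair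
  have hk : Measurable[prodAlgebra] fun p : UX2 ω X => f (fstU p) * g (sndU p) :=
    ((hf.comp measurable_fst).mul (hg.comp measurable_snd)).comp measurable_prodAlgebra_splitU
  have hk1 : ∀ᵐ p : UX2 ω X, |f (fstU p) * g (sndU p)| ≤ 1 := by
    filter_upwards [measurePreserving_fstU.quasiMeasurePreserving.ae hf1,
      measurePreserving_sndU.quasiMeasurePreserving.ae hg1] with p hfp hgp
    rw [abs_mul]
    exact mul_le_one₀ hfp (abs_nonneg _) hgp
  calc _ ≤ ∫ p : UX2 ω X, |pairing G (dstar p) - w (R.Ψ (fstU p), R.Ψ (sndU p))| :=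
        IsRNDPDerivative.abs_integral_sub_mul_le hdstar prodAlgebra_le aemeasurable_ultraDist G
          (integrable_of_measurable_of_abs_le (hv.mono prodAlgebra_le le_rfl) fun _ =>
            w.norm_coe_le_norm _) hk hk1
    _ = ∫ p : UX2 ω X, |pairing G (R.d (R.Ψ (fstU p)) (R.Ψ (sndU p)))
          - w (R.Ψ (fstU p), R.Ψ (sndU p))| :=
        integral_congr_ae (R.pullback_eq.mono fun p hp => by simp only [hp])
    _ = _ := R.integral_comp_pair ((R.measurable_pairing G).sub w.continuous.measurable).abs

theorem exists_tendsto_integral_distI_sub_mul (hdstar : IsDerivativeOfDist dstar)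
    (hΨn : ∀ n, Measurable (Ψn n)) (hlift : IsLifting Ψn R.Ψ) (G : C(I, ℝ)) (w : C(I × I, ℝ))
    {f g : ∀ n, X n → ℝ} (hf : ∀ n, Measurable (f n)) (hg : ∀ n, Measurable (g n))
    (hf1 : ∀ n x, |f n x| ≤ 1) (hg1 : ∀ n x, |g n x| ≤ 1) :
    ∃ L, Tendsto (fun n => ∫ p : X n × X n, (G ((X n).distI p.1 p.2) - w (Ψn n p.1, Ψn n p.2)) *
        (f n p.1 * g n p.2)) ω (𝓝 L) ∧
      |L| ≤ ∫ z, |pairing G (R.d z.1 z.2) - w z| ∂(R.μ : Measure I).prod R.μ := by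
  obtain ⟨f', hf', hff'⟩ := exists_isLifting_measurable_of_abs_le (ω := ω) hf hf1
  obtain ⟨g', hg', hgg'⟩ := exists_isLifting_measurable_of_abs_le (ω := ω) hg hg1
  refine ⟨_, IsLifting.tendsto_integral (C := (‖G‖ + ‖w‖) * 1)
    (((isLifting_ultraDist.comp_continuous G.continuous).sub (isLifting_comp_pair hlift w)).mul
      (hff'.comp_fstU.mul hgg'.comp_sndU)) (fun n => ?_) fun n p => ?_,
    abs_integral_ultraDist_sub_mul_le hdstar G w hf' hg' (hff'.ae_abs_le hf1)
      (hgg'.ae_abs_le hg1)⟩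
  · exact ((G.continuous.measurable.comp (X n).measurable_distI).sub
      (measurable_comp_pair hΨn w n)).mul
      (((hf n).comp measurable_fst).mul ((hg n).comp measurable_snd))
  · rw [abs_mul, abs_mul]
    exact mul_le_mul ((abs_sub _ _).trans
        (add_le_add (G.norm_coe_le_norm _) (w.norm_coe_le_norm _)))
      (mul_le_one₀ (hf1 n _) (abs_nonneg _) (hg1 n _)) (by positivity) (by positivity)

/-- Otherwise test functions violating the bound for `ω`-many `n` would have ultralimits violating
the bound for the derivative of the ultralimit distance. -/
theorem eventually_cutNormLE (hdstar : IsDerivativeOfDist dstar) (hΨn : ∀ n, Measurable (Ψn n))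
    (hlift : IsLifting Ψn R.Ψ) (G : C(I, ℝ)) (w : C(I × I, ℝ)) {δ : ℝ}
    (hδ : ∫ z, |pairing G (R.d z.1 z.2) - w z| ∂(R.μ : Measure I).prod R.μ < δ) :
    ∀ᶠ n in (ω : Filter ℕ), CutNormLE (volume : Measure (X n))
      (fun p => G ((X n).distI p.1 p.2) - w (Ψn n p.1, Ψn n p.2)) δ := by
  by_contra hbad
  have hex (n : ℕ) : ∃ f g : X n → ℝ, Measurable f ∧ Measurable g ∧ (∀ a, |f a| ≤ 1) ∧
      (∀ a, |g a| ≤ 1) ∧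
      (|∫ p : X n × X n, (G ((X n).distI p.1 p.2) - w (Ψn n p.1, Ψn n p.2)) *
        (f p.1 * g p.2)| ≤ δ → CutNormLE (volume : Measure (X n))
          (fun p => G ((X n).distI p.1 p.2) - w (Ψn n p.1, Ψn n p.2)) δ) := by
    by_cases h : CutNormLE (volume : Measure (X n))
      (fun p => G ((X n).distI p.1 p.2) - w (Ψn n p.1, Ψn n p.2)) δ
    · exact ⟨0, 0, measurable_zero, measurable_zero, by simp, by simp, fun _ => h⟩
    · simp only [CutNormLE, not_forall] at h
      obtain ⟨f, g, hf, hg, hf1, hg1, hfg⟩ := h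
      exact ⟨f, g, hf, hg, hf1, hg1, fun hle => absurd hle hfg⟩
  choose f g hf hg hf1 hg1 hfg using hex
  obtain ⟨L, hL, hLδ⟩ := exists_tendsto_integral_distI_sub_mul hdstar hΨn hlift G w hf hg hf1 hg1
  refine hbad ((hL.abs.eventually (gt_mem_nhds (hLδ.trans_lt hδ))).mono fun n hn => ?_)
  exact hfg n hn.le

end SeparableRealization

end CutNormConvergence

section Sampling

theorem exists_continuous_integral_abs_sub_lt {E : Type*} [TopologicalSpace E] [T2Space E]
    [CompactSpace E] [SecondCountableTopology E] [MeasurableSpace E] [BorelSpace E] (P : Measure E)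
    [IsProbabilityMeasure P] {h : E → ℝ} (hm : Measurable h) {C : ℝ} (hC : ∀ z, |h z| ≤ C) {δ : ℝ}
    (hδ : 0 < δ) :
    ∃ w : C(E, ℝ), (∀ z, |w z| ≤ C) ∧ ∫ z, |h z - w z| ∂P < δ := by
  have hhi := integrable_of_measurable_of_abs_le (P := P) hm hC
  obtain ⟨g, -, hg, hgc, hgi⟩ := hhi.exists_hasCompactSupport_integral_sub_le (half_pos hδ)
  have hC0 (z : E) : -C ≤ C := neg_le_self ((abs_nonneg _).trans (hC z))
  refine ⟨⟨fun z => max (min (g z) C) (-C), by fun_prop⟩,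
    fun z => abs_le.2 ⟨le_max_right _ _, max_le (min_le_right _ _) (hC0 z)⟩,
    (integral_mono_of_nonneg (Eventually.of_forall fun z => abs_nonneg _) (hhi.sub hgi).norm
      (Eventually.of_forall fun z => ?_)).trans_lt (hg.trans_lt (half_lt_self hδ))⟩
  have hclamp : h z = max (min (h z) C) (-C) := by
    rw [min_eq_left (abs_le.1 (hC z)).2, max_eq_left (abs_le.1 (hC z)).1]
  calc |h z - max (min (g z) C) (-C)| = |max (min (h z) C) (-C) - max (min (g z) C) (-C)| := by
        rw [← hclamp]
    _ ≤ |min (h z) C - min (g z) C| := abs_max_sub_max_le_abs _ _ _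
    _ ≤ |h z - g z| := (abs_min_sub_min_le_max _ _ _ _).trans_eq (by simp)

/-- The entry of a distance matrix at a pair of indices. -/
def entry (p : Pairs) : C(DistMatrix, I) :=
  ⟨fun m => m.1 p.1.1 p.1.2,
    (continuous_apply p.1.2).comp ((continuous_apply p.1.1).comp continuous_subtype_val)⟩

theorem entry_assemble (l : Pairs → I) (p : Pairs) : entry p (assemble l) = l p := by
  simp [entry, assemble, p.2]

theorem distMatrix_ext_entry {m m' : DistMatrix} (h : ∀ p, entry p m = entry p m') : m = m' := by
  refine Subtype.ext (funext fun i => funext fun j => ?_)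
  rcases lt_trichotomy i j with hij | rfl | hji
  · exact h ⟨(i, j), hij⟩
  · rw [m.2.2, m'.2.2]
  · rw [m.2.1 i j, m'.2.1 i j]
    exact h ⟨(j, i), hji⟩

instance : CompactSpace DistMatrix := by
  refine isCompact_iff_compactSpace.1 (IsClosed.isCompact (IsClosed.and ?_ ?_)) <;>
    simp only [ofPred_forall]
  · exact isClosed_iInter fun i => isClosed_iInter fun j => isClosed_eq (by fun_prop) (by fun_prop)
  · exact isClosed_iInter fun i => isClosed_eq (by fun_prop) (by fun_prop)

theorem integral_prod_entry_sampling (Y : MMSpace) (s : Finset Pairs) (G : Pairs → C(I, ℝ)) :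
    ∫ m, ∏ p ∈ s, G p (entry p m) ∂(Y.sampling : Measure DistMatrix)
      = ∫ x, ∏ p ∈ s, G p (Y.distI (pairAt x p).1 (pairAt x p).2)
          ∂Measure.infinitePi fun _ : ℕ => (volume : Measure Y) := by
  have hc : Continuous fun m : DistMatrix => ∏ p ∈ s, G p (entry p m) := by fun_prop
  exact integral_map Y.measurable_matrixOf.aemeasurable hc.aestronglyMeasurable

variable {Ω : Type*} [MeasurableSpace Ω] {d : Ω → Ω → ProbabilityMeasure I}

open ProbabilityTheory in
theorem integral_qSampling (μ : ProbabilityMeasure Ω) (hd : Measurable (Function.uncurry d))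
    (F : C(DistMatrix, ℝ)) :
    ∫ m, F m ∂(qSampling μ d hd : Measure DistMatrix)
      = ∫ x, ∫ m, F m ∂matrixLaw (qMatrixOf d x) ∂Measure.infinitePi fun _ => (μ : Measure Ω) := by
  have hlaw : Measurable fun x : ℕ → Ω =>
      (⟨matrixLaw (qMatrixOf d x), inferInstance⟩ : ProbabilityMeasure DistMatrix) :=
    (measurable_matrixLaw.comp (measurable_qMatrixOf hd)).subtype_mk
  have hcomp := Kernel.integral_comp (η := kernelOf hlaw)
    (κ := Kernel.const Unit (Measure.infinitePi fun _ : ℕ => (μ : Measure Ω))) (a := ()) (f := F)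
    (integrable_continuousMap (qSampling μ d hd : Measure DistMatrix) F)
  rw [Kernel.comp_apply, Kernel.const_apply] at hcomp
  exact hcomp

theorem integral_prod_entry_qSampling (μ : ProbabilityMeasure Ω)
    (hd : Measurable (Function.uncurry d)) (s : Finset Pairs) (G : Pairs → C(I, ℝ)) :
    ∫ m, ∏ p ∈ s, G p (entry p m) ∂(qSampling μ d hd : Measure DistMatrix)
      = ∫ x, ∏ p ∈ s, pairing (G p) (d (pairAt x p).1 (pairAt x p).2)
          ∂Measure.infinitePi fun _ => (μ : Measure Ω) := by
  have hc : Continuous fun m : DistMatrix => ∏ p ∈ s, G p (entry p m) := by fun_prop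
  refine (integral_qSampling μ hd ⟨_, hc⟩).trans (integral_congr_ae (.of_forall fun x => ?_))
  refine (integral_map measurable_assemble.aemeasurable hc.aestronglyMeasurable).trans ?_
  simp only [entry_assemble]
  exact integral_finset_prod_infinitePi _ s fun p => (G p).continuous.measurable

end Sampling

section Realization

variable {ω : Ultrafilter ℕ} [Nonprincipal ω]

theorem integral_prod_pairAt_map {Ω K : Type*} [MeasurableSpace Ω] [MeasurableSpace K]
    {μ : Measure Ω} [IsProbabilityMeasure μ] {φ : Ω → K} (hφ : Measurable φ) (s : Finset Pairs)
    {w : Pairs → K × K → ℝ} (hw : ∀ q, Measurable (w q)) :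
    ∫ y, ∏ q ∈ s, w q (pairAt y q) ∂Measure.infinitePi (fun _ => μ.map φ)
      = ∫ x, ∏ q ∈ s, w q (φ (pairAt x q).1, φ (pairAt x q).2) ∂Measure.infinitePi fun _ => μ := by
  have := Measure.isProbabilityMeasure_map (μ := μ) hφ.aemeasurable
  have hmap : Measurable fun x : ℕ → Ω => fun i => φ (x i) :=
    measurable_pi_lambda _ fun i => hφ.comp (measurable_pi_apply i)
  rw [← Measure.infinitePi_map_pi (fun _ => μ) fun _ => hφ]
  exact integral_map hmap.aemeasurable (measurable_prod_pairAt hw s).aestronglyMeasurable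

theorem IsLifting.tendsto_map {Y : ℕ → Type*} [∀ n, MeasureSpace (Y n)]
    [∀ n, IsProbabilityMeasure (volume : Measure (Y n))] {K : Type*} [TopologicalSpace K]
    [MeasurableSpace K] [OpensMeasurableSpace K] {F : ∀ n, Y n → K} {f : UltraProduct ω Y → K}
    (h : IsLifting F f) (hF : ∀ n, Measurable (F n)) (hf : Measurable f) :
    Tendsto (fun n => ProbabilityMeasure.map ⟨volume, inferInstance⟩ (hF n).aemeasurable) ω
      (𝓝 (ProbabilityMeasure.map ⟨volume, inferInstance⟩ hf.aemeasurable)) := by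
  refine ProbabilityMeasure.tendsto_iff_forall_integral_tendsto.2 fun g => ?_
  have hmapF (n : ℕ) : ∫ z, g z ∂volume.map (F n) = ∫ y, g (F n y) :=
    integral_map (hF n).aemeasurable g.continuous.measurable.aestronglyMeasurable
  have hmapf : ∫ z, g z ∂volume.map f = ∫ p, g (f p) :=
    integral_map hf.aemeasurable g.continuous.measurable.aestronglyMeasurable
  change Tendsto (fun n => ∫ z, g z ∂volume.map (F n)) ω (𝓝 (∫ z, g z ∂volume.map f))
  simp only [hmapF, hmapf]
  exact (h.comp_continuous g.continuous).tendsto_integral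
    (fun n => g.continuous.measurable.comp (hF n)) fun n y => g.norm_coe_le_norm _

variable {X : ℕ → MMSpace} {dstar : UX2 ω X → ProbabilityMeasure I}
  {R : SeparableRealization dstar} {Ψn : ∀ n, X n → I}

namespace SeparableRealization

theorem tendsto_integral_prod_comp_pair (hΨn : ∀ n, Measurable (Ψn n)) (hlift : IsLifting Ψn R.Ψ)
    (s : Finset Pairs) (w : Pairs → C(I × I, ℝ)) :
    Tendsto (fun n => ∫ x, ∏ q ∈ s, w q (Ψn n (pairAt x q).1, Ψn n (pairAt x q).2)
        ∂Measure.infinitePi fun _ => (volume : Measure (X n))) ω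
      (𝓝 (∫ y, ∏ q ∈ s, w q (pairAt y q) ∂Measure.infinitePi fun _ => (R.μ : Measure I))) := by
  have hpow := (continuous_infinitePower (ι := ℕ)).tendsto _ |>.comp
    (hlift.tendsto_map hΨn R.measurable_Ψ)
  have hW : Continuous fun y : ℕ → I => ∏ q ∈ s, w q (pairAt y q) :=
    continuous_finsetProd _ fun q _ => (w q).continuous.comp
      ((continuous_apply _).prodMk (continuous_apply _))
  refine (ProbabilityMeasure.tendsto_iff_forall_integral_tendsto.1 hpow
    (BoundedContinuousFunction.mkOfCompact ⟨_, hW⟩)).congr fun n => ?_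
  exact integral_prod_pairAt_map (μ := (volume : Measure (X n))) (hΨn n) s
    fun q => (w q).continuous.measurable

/-- Both sides change little when the functions of the distances are replaced by continuous
functions of the images under `Ψ`: the differences are small in the cut norm. -/
theorem tendsto_integral_prod_distI (hdstar : IsDerivativeOfDist dstar)
    (hΨn : ∀ n, Measurable (Ψn n)) (hlift : IsLifting Ψn R.Ψ) (s : Finset Pairs)
    {G : Pairs → C(I, ℝ)} (hG : ∀ q t, |G q t| ≤ 1) :
    Tendsto (fun n => ∫ x, ∏ q ∈ s, G q ((X n).distI (pairAt x q).1 (pairAt x q).2)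
        ∂Measure.infinitePi fun _ => (volume : Measure (X n))) ω
      (𝓝 (∫ y, ∏ q ∈ s, pairing (G q) (R.d (pairAt y q).1 (pairAt y q).2)
        ∂Measure.infinitePi fun _ => (R.μ : Measure I))) := by
  refine tendsto_of_forall_approx fun ε hε => ?_
  obtain ⟨δ, hδ, hsδ⟩ : ∃ δ > 0, s.card * δ ≤ ε :=
    ⟨ε / (s.card + 1), by positivity, by
      rw [mul_div_left_comm]
      exact mul_le_of_le_one_right hε.le ((div_le_one (by positivity)).2 (by linarith))⟩
  choose w hw1 hwδ using fun q => exists_continuous_integral_abs_sub_lt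
    ((R.μ : Measure I).prod R.μ) (R.measurable_pairing (G q)) (fun z => abs_pairing_le (hG q) _) hδ
  refine ⟨_, _, tendsto_integral_prod_comp_pair hΨn hlift s w, ?_, ?_⟩
  · have hcut := (Filter.eventually_all_finset s).2 fun q _ =>
      eventually_cutNormLE hdstar hΨn hlift (G q) (w q) (hwδ q)
    filter_upwards [hcut] with n hn
    exact (abs_integral_prod_sub_le (u := fun q p => G q ((X n).distI p.1 p.2))
      (v := fun q p => w q (Ψn n p.1, Ψn n p.2))
      (fun q => (G q).continuous.measurable.comp (X n).measurable_distI)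
      (fun q => measurable_comp_pair hΨn (w q) n) (fun q _ => hG q _) (fun q _ => hw1 q _)
      hn).trans hsδ
  · refine (abs_integral_prod_sub_le (u := fun q z => pairing (G q) (R.d z.1 z.2))
      (v := fun q => w q) (fun q => R.measurable_pairing (G q))
      (fun q => (w q).continuous.measurable) (fun q _ => abs_pairing_le (hG q) _) hw1
      fun q _ => CutNormLE.of_integral_abs_le ?_ (hwδ q).le).trans hsδ
    exact (integrable_of_measurable_of_abs_le (R.measurable_pairing (G q))
      fun z => abs_pairing_le (hG q) _).sub (integrable_continuousMap _ (w q))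

theorem tendsto_sampling (R : SeparableRealization dstar) (hdstar : IsDerivativeOfDist dstar) :
    Tendsto (fun n => (X n).sampling) ω (𝓝 (qSampling R.μ R.d R.measurable_d)) := by
  obtain ⟨Ψn, hΨn, hlift⟩ := exists_isLifting_unitInterval R.measurable_Ψ
  refine tendsto_of_forall_integral_prod entry (fun _ _ => distMatrix_ext_entry) fun s G hG => ?_
  simp only [integral_prod_entry_sampling, integral_prod_entry_qSampling]
  exact tendsto_integral_prod_distI hdstar hΨn hlift s hG

end SeparableRealization

end Realization

section Symmetry

open ProbabilityTheory in
theorem ae_eq_of_forall_integral_mul_pairing_eq {E : Type*} [TopologicalSpace E]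
    [HasOuterApproxClosed E] [MeasurableSpace E] [BorelSpace E] {ν : Measure E} [IsFiniteMeasure ν]
    {D D' : E → ProbabilityMeasure I} (hD : Measurable D) (hD' : Measurable D')
    (h : ∀ (f : BoundedContinuousFunction E ℝ) (G : C(I, ℝ)),
      ∫ z, f z * pairing G (D z) ∂ν = ∫ z, f z * pairing G (D' z) ∂ν) :
    D =ᵐ[ν] D' := by
  have hint {F : E → ProbabilityMeasure I} (hF : Measurable F) (f : BoundedContinuousFunction E ℝ)
      (G : BoundedContinuousFunction I ℝ) :
      ∫ p, f p.1 * G p.2 ∂(ν ⊗ₘ kernelOf hF) = ∫ z, f z * pairing G.toContinuousMap (F z) ∂ν := by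
    rw [Measure.integral_compProd]
    · simp only [integral_const_mul]
      rfl
    · refine Integrable.of_bound ((f.continuous.measurable.comp measurable_fst).mul
        (G.continuous.measurable.comp measurable_snd)).aestronglyMeasurable (‖f‖ * ‖G‖)
        (.of_forall fun p => ?_)
      rw [norm_mul]
      exact mul_le_mul (f.norm_coe_le_norm _) (G.norm_coe_le_norm _) (norm_nonneg _)
        (norm_nonneg _)
  have hcomp : ν ⊗ₘ kernelOf hD = ν ⊗ₘ kernelOf hD' :=
    Measure.ext_of_integral_mul_boundedContinuousFunction fun f G => by
      rw [hint, hint, h]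
  filter_upwards [Kernel.ae_eq_of_compProd_eq hcomp] with z hz
  exact Subtype.ext hz

variable {ω : Ultrafilter ℕ} [Nonprincipal ω] {X : ℕ → MMSpace}
  {dstar : UX2 ω X → ProbabilityMeasure I}

namespace SeparableRealization

theorem integral_mul_pairing_swap (R : SeparableRealization dstar)
    (hdstar : IsDerivativeOfDist dstar) (f : C(I × I, ℝ)) (G : C(I, ℝ)) :
    ∫ z, f z * pairing G (R.d z.1 z.2) ∂(R.μ : Measure I).prod R.μ
      = ∫ z, f z * pairing G (R.d z.2 z.1) ∂(R.μ : Measure I).prod R.μ := by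
  obtain ⟨Ψn, hΨn, hlift⟩ := exists_isLifting_unitInterval R.measurable_Ψ
  have hswap (n : ℕ) : ∫ p : X n × X n, f (Ψn n p.2, Ψn n p.1) * G ((X n).distI p.1 p.2)
      = ∫ p : X n × X n, f (Ψn n p.1, Ψn n p.2) * G ((X n).distI p.1 p.2) := by
    have hcomm (x y : X n) : (X n).distI x y = (X n).distI y x := Subtype.ext (dist_comm _ _)
    rw [Measure.volume_eq_prod, ← integral_prod_swap]
    simp only [Prod.fst_swap, Prod.snd_swap, hcomm]
  have hlim := tendsto_integral_mul_distI hdstar hΨn hlift G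
    (f.comp ⟨Prod.swap, continuous_swap⟩)
  rw [tendsto_nhds_unique (tendsto_integral_mul_distI hdstar hΨn hlift G f)
    (hlim.congr hswap), ← integral_prod_swap]
  rfl

theorem ae_symm (R : SeparableRealization dstar) (hdstar : IsDerivativeOfDist dstar) :
    ∀ᵐ z ∂(R.μ : Measure I).prod R.μ, R.d z.1 z.2 = R.d z.2 z.1 :=
  ae_eq_of_forall_integral_mul_pairing_eq (D := fun z : I × I => R.d z.1 z.2)
    (D' := fun z => R.d z.2 z.1) R.measurable_d (R.measurable_d.comp measurable_swap)
    fun f => R.integral_mul_pairing_swap hdstar f.toContinuousMap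

end SeparableRealization

end Symmetry

section Triangle

open ProbabilityTheory

theorem infinitePi_map_triple {ι Z : Type*} [MeasurableSpace Z] (μ : ι → Measure Z)
    [∀ i, IsProbabilityMeasure (μ i)] {a b c : ι} (hab : a ≠ b) (hac : a ≠ c) (hbc : b ≠ c) :
    (Measure.infinitePi μ).map (fun x => (x a, x b, x c)) = (μ a).prod ((μ b).prod (μ c)) := by
  classical
  have hm : Measurable fun x : ι → Z => (x a, x b, x c) := by fun_prop
  have : IsProbabilityMeasure ((Measure.infinitePi μ).map fun x => (x a, x b, x c)) :=
    Measure.isProbabilityMeasure_map hm.aemeasurable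
  refine Measure.ext_prod₃ fun {A B C} hA hB hC => ?_
  rw [Measure.map_apply hm (hA.prod (hB.prod hC)), Measure.prod_prod, Measure.prod_prod]
  let t : ι → Set Z := fun i => if i = a then A else if i = b then B else C
  have ha : t a = A := by simp [t]
  have hb : t b = B := by simp [t, hab.symm]
  have hc : t c = C := by simp [t, hac.symm, hbc.symm]
  have ht (i : ι) : MeasurableSet (t i) := by
    simp only [t]
    split_ifs <;> assumption
  have hpre : (fun x : ι → Z => (x a, x b, x c)) ⁻¹' A ×ˢ B ×ˢ C
      = (({a, b, c} : Finset ι) : Set ι).pi t := by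
    ext x
    simp [ha, hb, hc]
  rw [hpre, Measure.infinitePi_pi _ fun i _ => ht i, Finset.prod_insert (by simp [hab, hac]),
    Finset.prod_insert (by simp [hbc]), Finset.prod_singleton, ha, hb, hc]

theorem ae_prod_of_ae_infinitePi {ι Z : Type*} [MeasurableSpace Z] {μ : ι → Measure Z}
    [∀ i, IsProbabilityMeasure (μ i)] {a b c : ι} (hab : a ≠ b) (hac : a ≠ c) (hbc : b ≠ c)
    {S : Set (Z × Z × Z)} (hS : MeasurableSet S)
    (h : ∀ᵐ x ∂Measure.infinitePi μ, (x a, x b, x c) ∈ S) :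
    ∀ᵐ z ∂(μ a).prod ((μ b).prod (μ c)), z ∈ S := by
  rw [← infinitePi_map_triple μ hab hac hbc]
  exact (ae_map_iff (Measurable.aemeasurable (by fun_prop)) hS).2 h

/-- The triples of lengths satisfying the three triangle inequalities, ordered as in
`RandomTriangle`: the sides `ab`, `bc`, `ac` of a triangle `abc`. -/
def triangleSet : Set (I × I × I) :=
  {l | (l.2.2 : ℝ) ≤ l.1 + l.2.1 ∧ (l.1 : ℝ) ≤ l.2.1 + l.2.2 ∧ (l.2.1 : ℝ) ≤ l.1 + l.2.2}

theorem isClosed_triangleSet : IsClosed triangleSet :=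
  (isClosed_le (by fun_prop) (by fun_prop)).and
    ((isClosed_le (by fun_prop) (by fun_prop)).and (isClosed_le (by fun_prop) (by fun_prop)))

/-- The lengths of the sides `01`, `12`, `02` of the triangle of the first three points of a
distance matrix. -/
def sides (m : DistMatrix) : I × I × I :=
  (entry ⟨(0, 1), by norm_num⟩ m, entry ⟨(1, 2), by norm_num⟩ m, entry ⟨(0, 2), by norm_num⟩ m)

theorem continuous_sides : Continuous sides :=
  (entry _).continuous.prodMk ((entry _).continuous.prodMk (entry _).continuous)

theorem ae_sides_sampling_mem_triangleSet (X : MMSpace) :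
    ∀ᵐ m ∂(X.sampling : Measure DistMatrix), sides m ∈ triangleSet := by
  refine (ae_map_iff X.measurable_matrixOf.aemeasurable
    (isClosed_triangleSet.preimage continuous_sides).measurableSet).2 (.of_forall fun x => ?_)
  exact ⟨dist_triangle (x 0) (x 1) (x 2),
    (dist_triangle_right (x 0) (x 1) (x 2)).trans (add_comm _ _).le,
    dist_triangle_left (x 1) (x 2) (x 0)⟩

theorem ae_mem_of_tendsto_of_isClosed {E ι : Type*} [TopologicalSpace E] [MeasurableSpace E]
    [OpensMeasurableSpace E] [HasOuterApproxClosed E] {l : Filter ι} [l.NeBot]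
    {P : ι → ProbabilityMeasure E} {Q : ProbabilityMeasure E} (h : Tendsto P l (𝓝 Q)) {F : Set E}
    (hF : IsClosed F) (hPF : ∀ n, ∀ᵐ x ∂(P n : Measure E), x ∈ F) :
    ∀ᵐ x ∂(Q : Measure E), x ∈ F := by
  have hle := ProbabilityMeasure.le_liminf_measure_open_of_tendsto h hF.isOpen_compl
  have hzero (n : ι) : (P n : Measure E) Fᶜ = 0 := hPF n
  simp only [hzero, liminf_const, nonpos_iff_eq_zero] at hle
  exact hle

variable {Ω : Type*} [MeasurableSpace Ω] {d : Ω → Ω → ProbabilityMeasure I}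

theorem measurableSet_ae_mem_triangleSet (hd : Measurable (Function.uncurry d)) :
    MeasurableSet {p : Ω × Ω × Ω | ∀ᵐ l ∂(d p.1 p.2.1 : Measure I).prod
      ((d p.2.1 p.2.2 : Measure I).prod (d p.1 p.2.2)), l ∈ triangleSet} := by
  let κ : Kernel (Ω × Ω × Ω) (I × I × I) :=
    (kernelOf hd).comap (fun p => (p.1, p.2.1)) (by fun_prop) ×ₖ
      ((kernelOf hd).comap (fun p => (p.2.1, p.2.2)) (by fun_prop) ×ₖ
        (kernelOf hd).comap (fun p => (p.1, p.2.2)) (by fun_prop))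
  have hκ (p : Ω × Ω × Ω) : κ p = (d p.1 p.2.1 : Measure I).prod
      ((d p.2.1 p.2.2 : Measure I).prod (d p.1 p.2.2)) := by
    rw [Kernel.prod_apply, Kernel.prod_apply]
    rfl
  simp only [← hκ]
  exact Kernel.measurable_coe κ isClosed_triangleSet.measurableSet.compl
    (measurableSet_singleton 0)

theorem randomTriangle_of_ae_sides_mem {μ : ProbabilityMeasure Ω}
    {hd : Measurable (Function.uncurry d)}
    (h : ∀ᵐ m ∂(qSampling μ d hd : Measure DistMatrix), sides m ∈ triangleSet) :
    RandomTriangle μ d := by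
  refine ae_prod_of_ae_infinitePi (μ := fun _ : ℕ => (μ : Measure Ω)) (a := 0) (b := 1) (c := 2)
    (by norm_num) (by norm_num) (by norm_num) (measurableSet_ae_mem_triangleSet hd) ?_
  have hlaw := Measure.ae_ae_of_ae_bind
    (measurable_matrixLaw.comp (measurable_qMatrixOf hd)).aemeasurable h
  filter_upwards [hlaw] with x hx
  exact ae_prod_of_ae_infinitePi (μ := fun q => (qMatrixOf d x q : Measure I))
    (by simp) (by simp) (by simp) isClosed_triangleSet.measurableSet
    (ae_of_ae_map measurable_assemble.aemeasurable hx)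

theorem randomTriangle_of_tendsto_sampling {ι : Type*} {l : Filter ι} [l.NeBot] {X : ι → MMSpace}
    {μ : ProbabilityMeasure Ω} {hd : Measurable (Function.uncurry d)}
    (h : Tendsto (fun n => (X n).sampling) l (𝓝 (qSampling μ d hd))) : RandomTriangle μ d :=
  have : TopologicalSpace.MetrizableSpace DistMatrix := IsEmbedding.subtypeVal.metrizableSpace
  randomTriangle_of_ae_sides_mem (ae_mem_of_tendsto_of_isClosed h
    (isClosed_triangleSet.preimage continuous_sides)
    fun n => ae_sides_sampling_mem_triangleSet (X n))

end Triangle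

section Symmetrize

theorem RandomTriangle.congr_ae {Ω : Type*} [MeasurableSpace Ω] {μ : ProbabilityMeasure Ω}
    {d d' : Ω → Ω → ProbabilityMeasure I} (h : RandomTriangle μ d)
    (hd : ∀ᵐ p : Ω × Ω ∂(μ : Measure Ω).prod (μ : Measure Ω), d' p.1 p.2 = d p.1 p.2) :
    RandomTriangle μ d' := by
  have hid := MeasurePreserving.id (μ : Measure Ω)
  have h12 := (hid.prod (measurePreserving_fst (μ := (μ : Measure Ω))
    (ν := (μ : Measure Ω)))).quasiMeasurePreserving.ae hd
  have h13 := (hid.prod (measurePreserving_snd (μ := (μ : Measure Ω))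
    (ν := (μ : Measure Ω)))).quasiMeasurePreserving.ae hd
  have h23 := (measurePreserving_snd (μ := (μ : Measure Ω))
    (ν := (μ : Measure Ω).prod (μ : Measure Ω))).quasiMeasurePreserving.ae hd
  filter_upwards [h, h12, h13, h23] with p hp e12 e13 e23
  simp only [Prod.map_fst, Prod.map_snd, id] at e12 e13 e23
  rw [e12, e13, e23]
  exact hp

theorem ae_measure_singleton_ne_zero_of_eq {Ω : Type*} [MeasurableSpace Ω] [MeasurableEq Ω]
    (μ : Measure Ω) [SFinite μ] : ∀ᵐ p : Ω × Ω ∂μ.prod μ, p.1 = p.2 → μ {p.1} ≠ 0 := by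
  have hfiber (x : Ω) : Prod.mk x ⁻¹' diagonal Ω = {x} := by
    ext y
    simp [eq_comm]
  have hatomless : MeasurableSet {x : Ω | μ {x} = 0} := by
    have := measurable_measure_prodMk_left (ν := μ) (measurableSet_diagonal (α := Ω))
    simp only [hfiber] at this
    exact this (measurableSet_singleton 0)
  have hnull : (μ.prod μ) (diagonal Ω ∩ Prod.fst ⁻¹' {x : Ω | μ {x} = 0}) = 0 := by
    rw [Measure.measure_prod_null (measurableSet_diagonal.inter (measurable_fst hatomless))]
    refine .of_forall fun x => ?_
    by_cases hx : μ {x} = 0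
    · exact measure_mono_null (fun y hy => (mem_diagonal_iff.1 hy.1).symm) hx
    · simp [hx]
  filter_upwards [compl_mem_ae_iff.2 hnull] with p hp heq hzero
  exact hp ⟨heq, hzero⟩

/-- The symmetric function that is `δ_0` on the diagonal and agrees with `d` where `x < y`; it
turns the almost everywhere properties of a separable realization into everywhere ones. -/
def symmetrize (d : I → I → ProbabilityMeasure I) (x y : I) : ProbabilityMeasure I :=
  if x = y then diracI 0 else if x < y then d x y else d y x

theorem symmetrize_self (d : I → I → ProbabilityMeasure I) (x : I) :
    symmetrize d x x = diracI 0 := if_pos rfl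

theorem symmetrize_comm (d : I → I → ProbabilityMeasure I) (x y : I) :
    symmetrize d x y = symmetrize d y x := by
  rcases lt_trichotomy x y with h | rfl | h
  · simp [symmetrize, h.ne, h.ne', h, h.not_gt]
  · rfl
  · simp [symmetrize, h.ne, h.ne', h, h.not_gt]

theorem measurable_symmetrize {d : I → I → ProbabilityMeasure I}
    (hd : Measurable (Function.uncurry d)) : Measurable (Function.uncurry (symmetrize d)) :=
  Measurable.ite (measurableSet_eq_fun measurable_fst measurable_snd) measurable_const
    (Measurable.ite (measurableSet_lt measurable_fst measurable_snd) hd (hd.comp measurable_swap))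

theorem symmetrize_ae_eq {d : I → I → ProbabilityMeasure I} {μ : Measure I} [SFinite μ]
    (hsymm : ∀ᵐ p ∂μ.prod μ, d p.1 p.2 = d p.2 p.1)
    (hatom : ∀ x, μ {x} ≠ 0 → d x x = diracI 0) :
    ∀ᵐ p ∂μ.prod μ, symmetrize d p.1 p.2 = d p.1 p.2 := by
  filter_upwards [hsymm, ae_measure_singleton_ne_zero_of_eq μ] with p hp hdiag
  rcases lt_trichotomy p.1 p.2 with h | h | h
  · simp [symmetrize, h.ne, h]
  · rw [← h, hatom _ (hdiag h), symmetrize_self]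
  · simp [symmetrize, h.ne', h.not_gt, hp]

end Symmetrize

end UltraMM

end

theorem mainTheorem6 (ω : Ultrafilter ℕ) [UltraMM.Nonprincipal ω] (X : ℕ → UltraMM.MMSpace)
    (dstar : UltraMM.UX2 ω X → ProbabilityMeasure I) (hdstar : UltraMM.IsDerivativeOfDist dstar)
    (R : UltraMM.SeparableRealization dstar) :
    Tendsto (fun n => (X n).sampling) (ω : Filter ℕ) (𝓝 (UltraMM.qSampling R.μ R.d R.measurable_d)) ∧
    (∀ᵐ p : I × I ∂((R.μ : Measure I).prod (R.μ : Measure I)), R.d p.1 p.2 = R.d p.2 p.1) ∧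
    UltraMM.RandomTriangle R.μ R.d ∧
    ((∀ x, R.d x x = UltraMM.diracI 0) → (∀ x y, R.d x y = R.d y x) → UltraMM.IsQMM R.μ R.d) ∧
    ((∀ x, (R.μ : Measure I) {x} ≠ 0 → R.d x x = UltraMM.diracI 0) →
      ∃ d' : I → I → ProbabilityMeasure I,
        (∀ᵐ p : I × I ∂((R.μ : Measure I).prod (R.μ : Measure I)), d' p.1 p.2 = R.d p.1 p.2) ∧
        UltraMM.IsQMM R.μ d') := by
  have hlim := R.tendsto_sampling hdstar
  have hsymm := R.ae_symm hdstar
  have htri := UltraMM.randomTriangle_of_tendsto_sampling hlim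
  refine ⟨hlim, hsymm, htri, fun hdiag hs => ⟨R.measurable_d, hdiag, hs, htri⟩, fun hatom => ?_⟩
  have hd' := UltraMM.symmetrize_ae_eq hsymm hatom
  exact ⟨UltraMM.symmetrize R.d, hd', UltraMM.measurable_symmetrize R.measurable_d,
    UltraMM.symmetrize_self R.d, UltraMM.symmetrize_comm R.d, htri.congr_ae hd'⟩
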